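/- Let $(M,d)$ be a complete metric space that is doubling: for some $\kappa\in\mathbb N$ every open ball $B(x,2r)$ is covered by $\kappa$ open balls of radius $r$. Let $I$ be a finite set with $\#I\ge 2$, let $I^*=\bigcup_{n\ge1}I^n$ be the set of finite words, and call $\mathtt i,\mathtt j\in I^*$ incomparable, $\mathtt i\perp\mathtt j$, if no infinite word begins with both. Let $\{\varphi_i\}_{i\in I}$ be an iterated function system on $M$, that is, each $\varphi_i\colon M\to M$ is injective and satisfies $d(\varphi_i(x),\varphi_i(y))\le s\,d(x,y)$ for all $x,y$, with some $0<s<1$. Write $\varphi_{\mathtt i}=\varphi_{i_1}\circ\cdots\circ\varphi_{i_n}$ for $\mathtt i=(i_1,\dots,i_n)$, let $E$ be the invariant set (the unique nonempty compact set with $E=\bigcup_{i\in I}\varphi_i(E)$), and put $E_{\mathtt i}=\varphi_{\mathtt i}(E)$ and $E_\varnothing=E$. Assume that the system is semiconformal: $\operatorname{diam}(E)>0$, and there are constants $D\ge1$ and $0<\underline s_{\mathtt i}\le\overline s_{\mathtt i}<1$ with $\overline s_{\mathtt i}\le D\underline s_{\mathtt i}$ and $$\underline s_{\mathtt i}\,d(x,y)\le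 d(\varphi_{\mathtt i}(x),\varphi_{\mathtt i}(y))\le\overline s_{\mathtt i}\,d(x,y)\qquad(x,y\in M,\ \mathtt i\in I^*).$$ Let $P(t)=\lim_{n\to\infty}\frac1n\log\sum_{\mathtt i\in I^n}\operatorname{diam}(E_{\mathtt i})^t$ be the topological pressure, and let $\mathtt i^-$ be $\mathtt i$ without its last letter. For $x\in E$ and $r>0$ put $$Z(x,r)=\{\mathtt i\in I^*:\operatorname{diam}(E_{\mathtt i})\le r<\operatorname{diam}(E_{\mathtt i^-}),\ E_{\mathtt i}\cap B(x,r)\ne\emptyset\}.$$ Then there is exactly one $t\ge0$ with $P(t)=0$, and for this $t$ the following conditions are equivalent. 1. The ball condition: there is $0<\delta<1$ such that for every $x\in E$ there is $r_x>0$ such that for every $0<r<r_x$ there are points $x_{\mathtt i}\in M$ $(\mathtt i\in Z(x,r))$ with $\operatorname{dist}(x_{\mathtt i},E_{\mathtt i})<r$ for which the balls $B(x_{\mathtt i},\delta r)$, $\mathtt i\in Z(x,r)$, are pairwise disjoint. 2. The finite clustering property: $\sup_{x\in E}\limsup_{r\downarrow0}\#Z(x,r)<\infty$. 3. $\mathcal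 H^t(E)>0$, where $\mathcal H^t$ is the $t$-dimensional Hausdorff measure. 4. There are $x\in M$ and $\varepsilon>0$ such that $d(\varphi_{\mathtt i}(x),\varphi_{\mathtt j}(x))\ge\varepsilon(\underline s_{\mathtt i}+\underline s_{\mathtt j})$ whenever $\mathtt i\perp\mathtt j$. (As usual, conditions 1 and 2 include that $\{E_{\mathtt i}\}$ is a weakly controlled Moran construction. This means that the sets $E_{\mathtt i}$ are compact with positive diameter, $E_{\mathtt i}\subset E_{\mathtt i^-}$, and for some $D'\ge1$ and all $\mathtt i,\mathtt j\in I^*$: $\operatorname{diam}(E_{\mathtt i\mathtt j})\le D'\operatorname{diam}(E_{\mathtt i})\operatorname{diam}(E_{\mathtt j})$, $\operatorname{diam}(E_{\mathtt i})\ge D'^{-1}\operatorname{diam}(E_{\mathtt i^-})$, and $\max_{\mathtt i\in I^n}\operatorname{diam}(E_{\mathtt i})<D'^{-1}$ for some $n\ge1$. It holds for every semiconformal system. In conditions 1 and 2 the points $x$ range over the limit set of this construction, $\bigcup_{\mathtt u\in I^{\mathbb N}}\bigcap_{n\ge1}E_{\mathtt u|_n}$, which coincides with the invariant set $E$.) 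-/

import Mathlib

open Set Filter Topology MeasureTheory

/-- A metric space is doubling if for some natural number `κ` every ball of radius `2 * r` is
covered by at most `κ` balls of radius `r`. -/
def IsDoublingSpace (M : Type*) [MetricSpace M] : Prop :=
  ∃ κ : ℕ, ∀ (x : M) (r : ℝ), 0 < r →
    ∃ C : Finset M, C.card ≤ κ ∧ Metric.ball x (2 * r) ⊆ ⋃ y ∈ C, Metric.ball y r

namespace Moran

/-! ### Words

Finite words over `I` are lists; the set `I*` of finite words consists of the nonempty lists.
Infinite words are sequences `ℕ → I`. -/

/-- The initial segment of length `n` of an infinite word. -/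
def initialSegment {I : Type*} (u : ℕ → I) (n : ℕ) : List I :=
  List.ofFn fun k : Fin n => u k

/-- The set of all infinite words that begin with the finite word `w`. -/
def cylinder {I : Type*} (w : List I) : Set (ℕ → I) :=
  {u | initialSegment u w.length = w}

/-- Two (nonempty) finite words are incomparable if their cylinders are disjoint. -/
def Incomparable {I : Type*} (v w : List I) : Prop :=
  v ≠ [] ∧ w ≠ [] ∧ Disjoint (cylinder v) (cylinder w)

/-! ### Families of sets indexed by finite words

`X []` is the whole set from which the construction starts. In `stopping` it only serves as the
predecessor of the one-letter words, which matters for large radii only. -/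

/-- A weakly controlled Moran construction. -/
def IsWCMC {I M : Type*} [MetricSpace M] (X : List I → Set M) : Prop :=
  (∀ w, IsCompact (X w) ∧ 0 < Metric.diam (X w)) ∧
  ∃ D : ℝ, 1 ≤ D ∧
    (∀ w, w ≠ [] → X w ⊆ X w.dropLast) ∧
    (∃ n : ℕ, 1 ≤ n ∧ ∀ w : List I, w.length = n → Metric.diam (X w) < D⁻¹) ∧
    (∀ v w, v ≠ [] → w ≠ [] →
      Metric.diam (X (v ++ w)) ≤ D * Metric.diam (X v) * Metric.diam (X w)) ∧
    (∀ w, w ≠ [] → D⁻¹ * Metric.diam (X w.dropLast) ≤ Metric.diam (X w))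

/-- The limit set: the union over all infinite words `u` of the intersection of the sets
`X (u|n)`, `n ≥ 1`. -/
def limitSet {I M : Type*} (X : List I → Set M) : Set M :=
  {x | ∃ u : ℕ → I, ∀ n : ℕ, 1 ≤ n → x ∈ X (initialSegment u n)}

/-- `HasPressure X t p`: the limit defining the topological pressure at `t` exists and
equals `p`. -/
def HasPressure {I M : Type*} [Fintype I] [MetricSpace M] (X : List I → Set M) (t p : ℝ) :
    Prop :=
  Tendsto
    (fun n : ℕ => (1 / (n : ℝ)) *
      Real.log (∑ w : Fin n → I, Metric.diam (X (List.ofFn w)) ^ t))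
    atTop (𝓝 p)

/-- `Z(r)`: the words `w` with `diam (X w) ≤ r < diam (X w⁻)`, where `w⁻` is `w` without its last
letter. -/
def stopping {I M : Type*} [MetricSpace M] (X : List I → Set M) (r : ℝ) : Set (List I) :=
  {w | w ≠ [] ∧ Metric.diam (X w) ≤ r ∧ r < Metric.diam (X w.dropLast)}

/-- `Z(x, r)`: the words `w` in `Z(r)` such that `X w` meets the open ball `B(x, r)`. -/
def localStopping {I M : Type*} [MetricSpace M] (X : List I → Set M) (x : M) (r : ℝ) :
    Set (List I) :=
  {w | w ∈ stopping X r ∧ (X w ∩ Metric.ball x r).Nonempty}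

/-- The finite clustering property: `sup_{x ∈ E} limsup_{r ↓ 0} #Z(x, r) < ∞` on the limit
set `E`. -/
def FiniteClustering {I M : Type*} [MetricSpace M] (X : List I → Set M) : Prop :=
  ⨆ x ∈ limitSet X, limsup (fun r : ℝ => (localStopping X x r).encard) (𝓝[>] 0) < ⊤

/-- The ball condition: with one constant `δ ∈ (0, 1)`, for every point `x` of the limit set and
all small `r > 0`, one can choose for each `w ∈ Z(x, r)` a centre `c w` at distance less than `r`
from `X w` such that the balls `B(c w, δ r)`, `w ∈ Z(x, r)`, are pairwise disjoint. -/
def BallCondition {I M : Type*} [MetricSpace M] (X : List I → Set M) : Prop :=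
  ∃ δ : ℝ, 0 < δ ∧ δ < 1 ∧ ∀ x ∈ limitSet X, ∃ rx : ℝ, 0 < rx ∧ ∀ r : ℝ, 0 < r → r < rx →
    ∃ c : List I → M,
      (∀ w ∈ localStopping X x r, Metric.infDist (c w) (X w) < r) ∧
      (localStopping X x r).PairwiseDisjoint fun w => Metric.ball (c w) (δ * r)

/-! ### Iterated function systems -/

/-- An iterated function system: a family of contractive injections of `M` into itself. -/
structure IFS (I M : Type*) [MetricSpace M] where
  map : I → M → M
  injective : ∀ i, Function.Injective (map i)
  contractive : ∀ i, ∃ s : ℝ, 0 < s ∧ s < 1 ∧ ∀ x y, dist (map i x) (map i y) ≤ s * dist x y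

namespace IFS

/-- `φ_w = φ_{i₁} ∘ ⋯ ∘ φ_{iₙ}` for `w = [i₁, …, iₙ]`; the empty word gives the identity. -/
def wordMap {I M : Type*} [MetricSpace M] (F : IFS I M) : List I → M → M
  | [] => id
  | i :: w => F.map i ∘ F.wordMap w

/-- `E` is the invariant set: the (unique) nonempty compact set with `E = ⋃ i, φ_i(E)`. -/
def IsInvariantSet {I M : Type*} [MetricSpace M] (F : IFS I M) (E : Set M) : Prop :=
  E.Nonempty ∧ IsCompact E ∧ E = ⋃ i, F.map i '' E

/-- The system with invariant set `E` is semiconformal with the constants `D`, `lo w`, `hi w`. -/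
def IsSemiconformal {I M : Type*} [MetricSpace M] (F : IFS I M) (E : Set M)
    (D : ℝ) (lo hi : List I → ℝ) : Prop :=
  0 < Metric.diam E ∧ 1 ≤ D ∧
  ∀ w : List I, w ≠ [] →
    0 < lo w ∧ lo w ≤ hi w ∧ hi w < 1 ∧ hi w ≤ D * lo w ∧
    ∀ x y : M, lo w * dist x y ≤ dist (F.wordMap w x) (F.wordMap w y) ∧
      dist (F.wordMap w x) (F.wordMap w y) ≤ hi w * dist x y

/-- The sets `φ_w(E)`. -/
def pieces {I M : Type*} [MetricSpace M] (F : IFS I M) (E : Set M) (w : List I) : Set M :=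
  F.wordMap w '' E

/-- The system (with invariant set `E`) satisfies the ball condition: the sets `φ_w(E)`
constitute a weakly controlled Moran construction that satisfies the ball condition. -/
def BallCondition {I M : Type*} [MetricSpace M] (F : IFS I M) (E : Set M) : Prop :=
  IsWCMC (F.pieces E) ∧ Moran.BallCondition (F.pieces E)

/-- The system (with invariant set `E`) has the finite clustering property: the sets `φ_w(E)`
constitute a weakly controlled Moran construction that has the finite clustering property. -/
def FiniteClustering {I M : Type*} [MetricSpace M] (F : IFS I M) (E : Set M) : Prop :=
  IsWCMC (F.pieces E) ∧ Moran.FiniteClustering (F.pieces E)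

end IFS

end Moran

/-!
Let `E` be the invariant set, write `d w` for the diameter of `φ_w(E)`, and let `t` be the zero of
the pressure. Semiconformality says that `φ_w` scales all distances by `d w` up to a constant
(`IFS.ConformalBounds`), so `d` is multiplicative under concatenation of words up to a constant
(`QuasiMult`).

*The pressure.* Fekete's lemma, applied to the logarithms of the level sums of `d ^ t`, gives the
pressure; it is Lipschitz continuous and strictly decreasing, and it changes sign
(`QuasiMult.existsUnique_pressure_zero`). At its zero the level sums are bounded from above and
below (`QuasiMult.levelSum_bounds`), and so there is an additive function `m` on words, a mass
distribution on the infinite words, that is comparable to `d ^ t` (`QuasiMult.exists_additive`).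

*The ball condition and finite clustering* are equivalent: disjoint balls of radius `δ r` near a
point are bounded in number in a doubling space (`BallCondition.finiteClustering`). Conversely, `E`
is infinite, so each of the boundedly many pieces near the point contains sufficiently many
separated points for a greedy choice of the centres (`IFS.ConformalBounds.ballCondition`).

*Finite clustering implies positive Hausdorff measure.* If the measure vanished, then `E` would be
covered by finitely many balls with small sum of the `t`-th powers of the radii. The words
of the sets `Z(x, r)` belonging to these balls are few, but every infinite word begins with one of
them, so they would have to carry the total mass (`IFS.ConformalBounds.hausdorffMeasure_pos`).

*Positive Hausdorff measure implies separated orbits.* If many pieces were contained in a set `A`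
of small diameter, then covering these pieces by the single set `A`, and their copies in `φ_v(E)` by
`φ_v(A)`, would be so economical that the content of `E` vanishes. Hence the mass of the pieces
inside `A` is at most a multiple of `diam A ^ t` (`IFS.ConformalBounds.exists_sum_le_mul_diam`), and
the number of incomparable pieces that come close to each other, relative to their sizes, is bounded
(`IFS.ConformalBounds.exists_cluster_bound`). Take a cluster with the largest number of pieces
that is possible at arbitrarily small relative scales, and let `y` be its centre. If `φ_v(y)` and
`φ_w(y)` were too close for some incomparable `v` and `w`, then the image of the cluster under `φ_v`
and one further piece containing `φ_w(y)` would be a larger cluster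
(`IFS.ConformalBounds.hasCluster_succ`). So `y` has separated images.

*Separated orbits imply finite clustering*, as a separated set in a ball of a doubling space is
finite with a bound on its cardinality (`IFS.ConformalBounds.finiteClustering_of_separated`).
-/

namespace Moran

/-! ### Quasi-multiplicative functions on words -/

section Words

variable {I : Type*} [Fintype I]

/-- The sum of `f` over the extensions of the word `w` by `n` letters. -/
def levelSum (f : List I → ℝ) : ℕ → List I → ℝ
  | 0, w => f w
  | n + 1, w => ∑ i, levelSum f n (w ++ [i])

theorem levelSum_append (f : List I → ℝ) (w : List I) (n : ℕ) (v : List I) :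
    levelSum f n (w ++ v) = levelSum (fun u => f (w ++ u)) n v := by
  induction n generalizing v with
  | zero => rfl
  | succ n ih => simp only [levelSum, List.append_assoc, ih]

theorem levelSum_le_levelSum {f g : List I → ℝ} (n : ℕ) (w : List I)
    (h : ∀ v, v.length = w.length + n → f v ≤ g v) : levelSum f n w ≤ levelSum g n w := by
  induction n generalizing w with
  | zero => exact h w rfl
  | succ n ih =>
    refine Finset.sum_le_sum fun i _ => ih _ fun v hv => h v ?_
    rw [hv, List.length_append, List.length_singleton]
    omega

theorem levelSum_mono {f g : List I → ℝ} (h : ∀ w, f w ≤ g w) (n : ℕ) (w : List I) :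
    levelSum f n w ≤ levelSum g n w :=
  levelSum_le_levelSum n w fun v _ => h v

theorem levelSum_const_mul (c : ℝ) (f : List I → ℝ) (n : ℕ) (w : List I) :
    levelSum (fun u => c * f u) n w = c * levelSum f n w := by
  induction n generalizing w with
  | zero => rfl
  | succ n ih => simp only [levelSum, ih, Finset.mul_sum]

theorem levelSum_add (f : List I → ℝ) (n m : ℕ) (w : List I) :
    levelSum f (n + m) w = levelSum (levelSum f m) n w := by
  induction n generalizing w with
  | zero => simp [levelSum]
  | succ n ih => rw [Nat.succ_add]; simp only [levelSum, ih]

theorem levelSum_pos [Nonempty I] {f : List I → ℝ} (h : ∀ w, 0 < f w) (n : ℕ) (w : List I) :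
    0 < levelSum f n w := by
  induction n generalizing w with
  | zero => exact h w
  | succ n ih => exact Finset.sum_pos (fun i _ => ih _) Finset.univ_nonempty

theorem sum_ofFn_eq_levelSum (f : List I → ℝ) (n : ℕ) (w : List I) :
    ∑ u : Fin n → I, f (w ++ List.ofFn u) = levelSum f n w := by
  induction n generalizing w with
  | zero => simp [levelSum]
  | succ n ih =>
    rw [← (Fin.consEquiv fun _ : Fin (n + 1) => I).sum_comp, Fintype.sum_prod_type]
    refine Finset.sum_congr rfl fun i _ => ?_
    rw [← ih]
    refine Finset.sum_congr rfl fun u _ => ?_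
    simp [Fin.consEquiv, List.ofFn_succ]

/-- A positive function on words that is multiplicative under concatenation up to the
factor `C`. -/
structure QuasiMult (f : List I → ℝ) (C : ℝ) : Prop where
  one_le : 1 ≤ C
  pos : ∀ w, 0 < f w
  append_le : ∀ v w, f (v ++ w) ≤ C * (f v * f w)
  le_append : ∀ v w, f v * f w ≤ C * f (v ++ w)

namespace QuasiMult

omit [Fintype I] in
theorem rpow {d : List I → ℝ} {Q : ℝ} (h : QuasiMult d Q) {t : ℝ} (ht : 0 ≤ t) :
    QuasiMult (fun w => d w ^ t) (Q ^ t) where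
  one_le := Real.one_le_rpow h.one_le ht
  pos w := Real.rpow_pos_of_pos (h.pos w) t
  append_le v w := by
    rw [← Real.mul_rpow (h.pos v).le (h.pos w).le,
      ← Real.mul_rpow (zero_le_one.trans h.one_le) (mul_pos (h.pos v) (h.pos w)).le]
    exact Real.rpow_le_rpow (h.pos _).le (h.append_le v w) ht
  le_append v w := by
    rw [← Real.mul_rpow (h.pos v).le (h.pos w).le,
      ← Real.mul_rpow (zero_le_one.trans h.one_le) (h.pos _).le]
    exact Real.rpow_le_rpow (mul_pos (h.pos v) (h.pos w)).le (h.le_append v w) ht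

variable {f : List I → ℝ} {C : ℝ}

theorem levelSum_le (h : QuasiMult f C) (n : ℕ) (w : List I) :
    levelSum f n w ≤ C * (f w * levelSum f n []) := by
  calc levelSum f n w = levelSum (fun u => f (w ++ u)) n [] := by
        simpa using levelSum_append f w n []
    _ ≤ levelSum (fun u => C * f w * f u) n [] :=
        levelSum_mono (fun u => by simpa [mul_assoc] using h.append_le w u) n []
    _ = _ := by rw [levelSum_const_mul, mul_assoc]

theorem le_levelSum (h : QuasiMult f C) (n : ℕ) (w : List I) :
    f w * levelSum f n [] ≤ C * levelSum f n w := by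
  calc f w * levelSum f n [] = levelSum (fun u => f w * f u) n [] := by
        rw [levelSum_const_mul]
    _ ≤ levelSum (fun u => C * f (w ++ u)) n [] := levelSum_mono (fun u => h.le_append w u) n []
    _ = C * levelSum f n w := by
        rw [levelSum_const_mul]
        congr 1
        simpa using (levelSum_append f w n []).symm

theorem levelSum_add_le (h : QuasiMult f C) (n m : ℕ) :
    levelSum f (n + m) [] ≤ C * (levelSum f n [] * levelSum f m []) := by
  calc levelSum f (n + m) [] = levelSum (levelSum f m) n [] := levelSum_add f n m []
    _ ≤ levelSum (fun w => C * levelSum f m [] * f w) n [] :=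
        levelSum_mono (fun w => (h.levelSum_le m w).trans_eq (by ring)) n []
    _ = _ := by rw [levelSum_const_mul]; ring

theorem le_levelSum_add (h : QuasiMult f C) (n m : ℕ) :
    levelSum f n [] * levelSum f m [] ≤ C * levelSum f (n + m) [] := by
  calc levelSum f n [] * levelSum f m [] = levelSum (fun w => levelSum f m [] * f w) n [] := by
        rw [levelSum_const_mul, mul_comm]
    _ ≤ levelSum (fun w => C * levelSum f m w) n [] :=
        levelSum_mono (fun w => (by rw [mul_comm]; exact h.le_levelSum m w)) n []
    _ = _ := by rw [levelSum_const_mul, levelSum_add]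

variable [Nonempty I]

theorem subadditive_log (h : QuasiMult f C) :
    Subadditive fun n => Real.log (levelSum f n []) + Real.log C := fun m n => by
  have hC : 0 < C := zero_lt_one.trans_le h.one_le
  have hm := levelSum_pos h.pos m []
  have hn := levelSum_pos h.pos n []
  have := Real.log_le_log (levelSum_pos h.pos (m + n) []) (h.levelSum_add_le m n)
  rw [Real.log_mul hC.ne' (mul_pos hm hn).ne', Real.log_mul hm.ne' hn.ne'] at this
  linarith

theorem subadditive_neg_log (h : QuasiMult f C) :
    Subadditive fun n => Real.log C - Real.log (levelSum f n []) := fun m n => by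
  have hC : 0 < C := zero_lt_one.trans_le h.one_le
  have hm := levelSum_pos h.pos m []
  have hn := levelSum_pos h.pos n []
  have := Real.log_le_log (mul_pos hm hn) (h.le_levelSum_add m n)
  rw [Real.log_mul hC.ne' (levelSum_pos h.pos (m + n) []).ne', Real.log_mul hm.ne' hn.ne'] at this
  linarith

end QuasiMult

omit [Fintype I] in
theorem tendsto_div_add_const (u : ℕ → ℝ) (c p : ℝ) :
    Tendsto (fun n : ℕ => (u n + c) / n) atTop (𝓝 p) ↔
      Tendsto (fun n : ℕ => (1 / (n : ℝ)) * u n) atTop (𝓝 p) := by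
  have hc : Tendsto (fun n : ℕ => c / (n : ℝ)) atTop (𝓝 0) :=
    tendsto_const_div_atTop_nhds_zero_nat c
  constructor
  · intro h
    have := h.sub hc
    rw [sub_zero] at this
    exact this.congr fun n => by ring
  · intro h
    have := h.add hc
    rw [add_zero] at this
    exact this.congr fun n => by ring

omit [Fintype I] in
/-- A subadditive sequence grows at most linearly. -/
theorem exists_le_mul_of_subadditive {u : ℕ → ℝ} (h : Subadditive u) :
    ∃ a : ℝ, 0 ≤ a ∧ ∀ n : ℕ, n ≠ 0 → u n ≤ n * a := by
  refine ⟨|u 0| + |u 1|, by positivity, fun n hn => ?_⟩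
  have h1 := h.apply_mul_add_le n 1 0
  have hn' : (1 : ℝ) ≤ n := by exact_mod_cast Nat.one_le_iff_ne_zero.mpr hn
  simp only [mul_one, add_zero] at h1
  nlinarith [le_abs_self (u 0), le_abs_self (u 1), abs_nonneg (u 0), abs_nonneg (u 1)]

namespace QuasiMult

variable {f : List I → ℝ} {C : ℝ} [Nonempty I]

theorem bddBelow_log_div (h : QuasiMult f C) :
    BddBelow (range fun n : ℕ => (Real.log (levelSum f n []) + Real.log C) / n) := by
  obtain ⟨a, ha, hu⟩ := exists_le_mul_of_subadditive h.subadditive_neg_log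
  refine ⟨-a, ?_⟩
  rintro _ ⟨n, rfl⟩
  rcases eq_or_ne n 0 with rfl | hn
  · simpa using ha
  have hn' : (0 : ℝ) < n := by exact_mod_cast Nat.pos_of_ne_zero hn
  have := hu n hn
  have hC := Real.log_nonneg h.one_le
  simp only
  rw [le_div_iff₀ hn']
  linarith

theorem bddBelow_neg_log_div (h : QuasiMult f C) :
    BddBelow (range fun n : ℕ => (Real.log C - Real.log (levelSum f n [])) / n) := by
  obtain ⟨a, ha, hu⟩ := exists_le_mul_of_subadditive h.subadditive_log
  refine ⟨-a, ?_⟩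
  rintro _ ⟨n, rfl⟩
  rcases eq_or_ne n 0 with rfl | hn
  · simpa using ha
  have hn' : (0 : ℝ) < n := by exact_mod_cast Nat.pos_of_ne_zero hn
  have := hu n hn
  have hC := Real.log_nonneg h.one_le
  simp only
  rw [le_div_iff₀ hn']
  linarith

theorem exists_tendsto_log (h : QuasiMult f C) :
    ∃ p, Tendsto (fun n : ℕ => (1 / (n : ℝ)) * Real.log (levelSum f n [])) atTop (𝓝 p) :=
  ⟨_, (tendsto_div_add_const _ _ _).1 (h.subadditive_log.tendsto_lim h.bddBelow_log_div)⟩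

/-- If the exponential growth rate of the level sums vanishes, then the level sums stay between
`C⁻¹` and `C`: the growth rate is the infimum in Fekete's lemma, for the sequence and for its
negative. -/
theorem levelSum_bounds (h : QuasiMult f C)
    (hp : Tendsto (fun n : ℕ => (1 / (n : ℝ)) * Real.log (levelSum f n [])) atTop (𝓝 0))
    {n : ℕ} (hn : n ≠ 0) : C⁻¹ ≤ levelSum f n [] ∧ levelSum f n [] ≤ C := by
  have hC : 0 < C := zero_lt_one.trans_le h.one_le
  have hn' : (0 : ℝ) < n := by exact_mod_cast Nat.pos_of_ne_zero hn
  have hS := levelSum_pos h.pos n []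
  have e1 : h.subadditive_log.lim = 0 :=
    tendsto_nhds_unique (h.subadditive_log.tendsto_lim h.bddBelow_log_div)
      ((tendsto_div_add_const _ _ _).2 hp)
  have e2 : h.subadditive_neg_log.lim = 0 := by
    refine tendsto_nhds_unique (h.subadditive_neg_log.tendsto_lim h.bddBelow_neg_log_div) ?_
    have := ((tendsto_div_add_const _ (-Real.log C) _).2 hp).neg
    rw [neg_zero] at this
    exact this.congr fun n => by ring
  have l1 := h.subadditive_log.lim_le_div h.bddBelow_log_div hn
  have l2 := h.subadditive_neg_log.lim_le_div h.bddBelow_neg_log_div hn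
  rw [e1, le_div_iff₀ hn', zero_mul] at l1
  rw [e2, le_div_iff₀ hn', zero_mul] at l2
  constructor
  · rw [← Real.log_le_log_iff (inv_pos.2 hC) hS, Real.log_inv]
    linarith
  · rw [← Real.log_le_log_iff hS hC]
    linarith

omit [Nonempty I] in
/-- A quasi-multiplicative function whose level sums are bounded from above and below is
comparable to an additive one, `m w = ∑ i, m (w ++ [i])`. The function `m` is a limit, along an
ultrafilter, of the sums of `f` over the extensions of `w` of a given total length; it plays the
role of a measure on infinite words with `m w` the mass of the cylinder of `w`. -/
theorem exists_additive (h : QuasiMult f C)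
    (hS : ∀ n : ℕ, n ≠ 0 → C⁻¹ ≤ levelSum f n [] ∧ levelSum f n [] ≤ C) :
    ∃ m : List I → ℝ, (∀ w, m w = ∑ i, m (w ++ [i])) ∧
      (∀ w, f w ≤ C ^ 2 * m w) ∧ ∀ w, m w ≤ C ^ 2 * f w := by
  have hC : 0 < C := zero_lt_one.trans_le h.one_le
  let T : List I → ℕ → ℝ := fun w n => levelSum f (n - w.length) w
  have hT : ∀ w, ∀ᶠ n in (hyperfilter ℕ : Filter ℕ),
      T w n ∈ Icc (f w / C ^ 2) (C ^ 2 * f w) := by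
    intro w
    have hev : ∀ᶠ n : ℕ in (hyperfilter ℕ : Filter ℕ), w.length < n :=
      (Nat.hyperfilter_le_atTop) (eventually_gt_atTop w.length)
    filter_upwards [hev] with n hn
    obtain ⟨h1, h2⟩ := hS (n - w.length) (by omega)
    have hfw := h.pos w
    constructor
    · rw [div_le_iff₀ (by positivity)]
      have h3 := h.le_levelSum (n - w.length) w
      have h4 : f w * C⁻¹ ≤ C * T w n := (mul_le_mul_of_nonneg_left h1 hfw.le).trans h3
      rw [mul_inv_le_iff₀ hC] at h4
      linarith
    · refine (h.levelSum_le _ _).trans ?_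
      calc C * (f w * levelSum f (n - w.length) []) ≤ C * (f w * C) := by gcongr
        _ = _ := by ring
  have hlim : ∀ w, ∃ x ∈ Icc (f w / C ^ 2) (C ^ 2 * f w),
      Tendsto (T w) (hyperfilter ℕ : Filter ℕ) (𝓝 x) := by
    intro w
    obtain ⟨x, hx, hle⟩ := isCompact_Icc.ultrafilter_le_nhds ((hyperfilter ℕ).map (T w))
      (le_principal_iff.2 (hT w))
    exact ⟨x, hx, hle⟩
  choose m hm hmT using hlim
  refine ⟨m, fun w => ?_, fun w => ?_, fun w => (hm w).2⟩
  · refine tendsto_nhds_unique (hmT w) ((tendsto_finsetSum _ fun i _ => hmT (w ++ [i])).congr' ?_)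
    have hev : ∀ᶠ n : ℕ in (hyperfilter ℕ : Filter ℕ), w.length < n :=
      (Nat.hyperfilter_le_atTop) (eventually_gt_atTop w.length)
    filter_upwards [hev] with n hn
    obtain ⟨k, rfl⟩ : ∃ k, n = w.length + (k + 1) := ⟨n - w.length - 1, by omega⟩
    have e : ∀ i : I, w.length + (k + 1) - (w ++ [i]).length = k := fun i => by
      simp only [List.length_append, List.length_singleton]; omega
    simp only [T, e, Nat.add_sub_cancel_left, levelSum]
  · have := (hm w).1
    rw [div_le_iff₀ (by positivity)] at this
    linarith

end QuasiMult

end Words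

/-! ### The zero of the pressure -/

section Pressure

variable {I : Type*} [Fintype I]

theorem levelSum_one (n : ℕ) (w : List I) :
    levelSum (fun _ => 1) n w = (Fintype.card I : ℝ) ^ n := by
  induction n generalizing w with
  | zero => simp [levelSum]
  | succ n ih => simp [levelSum, ih, pow_succ']

theorem tendsto_log_levelSum_one :
    Tendsto (fun n : ℕ => (1 / (n : ℝ)) * Real.log (levelSum (fun _ : List I => (1 : ℝ)) n []))
      atTop (𝓝 (Real.log (Fintype.card I))) := by
  refine tendsto_const_nhds.congr' ?_
  filter_upwards [eventually_ne_atTop 0] with n hn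
  have : (n : ℝ) ≠ 0 := by exact_mod_cast hn
  rw [levelSum_one, Real.log_pow]
  field_simp

omit [Fintype I] in
theorem tendsto_div_add_linear {u : ℕ → ℝ} {p : ℝ} (a b : ℝ)
    (h : Tendsto (fun n : ℕ => (1 / (n : ℝ)) * u n) atTop (𝓝 p)) :
    Tendsto (fun n : ℕ => (1 / (n : ℝ)) * (u n + (a + n * b))) atTop (𝓝 (p + b)) := by
  have ha : Tendsto (fun n : ℕ => a / (n : ℝ)) atTop (𝓝 0) :=
    tendsto_const_div_atTop_nhds_zero_nat a
  have := (h.add ha).add_const b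
  rw [add_zero] at this
  refine this.congr' ?_
  filter_upwards [eventually_ne_atTop 0] with n hn
  have : (n : ℝ) ≠ 0 := by exact_mod_cast hn
  field_simp
  ring

variable [Nonempty I] {d : List I → ℝ} {t h p q A s : ℝ}

theorem log_levelSum_rpow_le (hd : ∀ w, 0 < d w) (hA : 0 < A) (hs : 0 < s)
    (hle : ∀ w, d w ≤ A * s ^ w.length) (hh : 0 ≤ h) (n : ℕ) :
    Real.log (levelSum (fun w => d w ^ (t + h)) n []) ≤
      Real.log (levelSum (fun w => d w ^ t) n []) + (h * Real.log A + n * (h * Real.log s)) := by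
  have hpos : ∀ t : ℝ, 0 < levelSum (fun w => d w ^ t) n [] := fun t =>
    levelSum_pos (fun w => Real.rpow_pos_of_pos (hd w) t) n []
  have hc : 0 < A * s ^ n := by positivity
  have key : levelSum (fun w => d w ^ (t + h)) n [] ≤
      (A * s ^ n) ^ h * levelSum (fun w => d w ^ t) n [] := by
    rw [← levelSum_const_mul]
    refine levelSum_le_levelSum n [] fun v hv => ?_
    have hv' : v.length = n := by simpa using hv
    rw [Real.rpow_add (hd v), mul_comm]
    gcongr
    · exact (Real.rpow_pos_of_pos (hd v) t).le
    · exact (hd v).le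
    · exact hv' ▸ hle v
  refine (Real.log_le_log (hpos _) key).trans_eq ?_
  rw [Real.log_mul (Real.rpow_pos_of_pos hc h).ne' (hpos t).ne', Real.log_rpow hc,
    Real.log_mul hA.ne' (by positivity), Real.log_pow]
  ring

theorem le_log_levelSum_rpow (hd : ∀ w, 0 < d w) (hA : 0 < A) (hs : 0 < s)
    (hle : ∀ w, A * s ^ w.length ≤ d w) (hh : 0 ≤ h) (n : ℕ) :
    Real.log (levelSum (fun w => d w ^ t) n []) + (h * Real.log A + n * (h * Real.log s)) ≤
      Real.log (levelSum (fun w => d w ^ (t + h)) n []) := by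
  have hpos : ∀ t : ℝ, 0 < levelSum (fun w => d w ^ t) n [] := fun t =>
    levelSum_pos (fun w => Real.rpow_pos_of_pos (hd w) t) n []
  have hc : 0 < A * s ^ n := by positivity
  have key : (A * s ^ n) ^ h * levelSum (fun w => d w ^ t) n [] ≤
      levelSum (fun w => d w ^ (t + h)) n [] := by
    rw [← levelSum_const_mul]
    refine levelSum_le_levelSum n [] fun v hv => ?_
    have hv' : v.length = n := by simpa using hv
    rw [Real.rpow_add (hd v), mul_comm]
    gcongr
    · exact (Real.rpow_pos_of_pos (hd v) t).le
    · exact hv' ▸ hle v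
  refine le_trans (Eq.le ?_) (Real.log_le_log (by have := hpos t; positivity) key)
  rw [Real.log_mul (Real.rpow_pos_of_pos hc h).ne' (hpos t).ne', Real.log_rpow hc,
    Real.log_mul hA.ne' (by positivity), Real.log_pow]
  ring

theorem pressure_add_le (hd : ∀ w, 0 < d w) (hA : 0 < A) (hs : 0 < s)
    (hle : ∀ w, d w ≤ A * s ^ w.length) (hh : 0 ≤ h)
    (hp : Tendsto (fun n : ℕ => (1 / (n : ℝ)) *
      Real.log (levelSum (fun w => d w ^ t) n [])) atTop (𝓝 p))
    (hq : Tendsto (fun n : ℕ => (1 / (n : ℝ)) *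
      Real.log (levelSum (fun w => d w ^ (t + h)) n [])) atTop (𝓝 q)) :
    q ≤ p + h * Real.log s :=
  le_of_tendsto_of_tendsto' hq (tendsto_div_add_linear (h * Real.log A) _ hp) fun n =>
    mul_le_mul_of_nonneg_left (log_levelSum_rpow_le hd hA hs hle hh n) (by positivity)

theorem le_pressure_add (hd : ∀ w, 0 < d w) (hA : 0 < A) (hs : 0 < s)
    (hle : ∀ w, A * s ^ w.length ≤ d w) (hh : 0 ≤ h)
    (hp : Tendsto (fun n : ℕ => (1 / (n : ℝ)) *
      Real.log (levelSum (fun w => d w ^ t) n [])) atTop (𝓝 p))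
    (hq : Tendsto (fun n : ℕ => (1 / (n : ℝ)) *
      Real.log (levelSum (fun w => d w ^ (t + h)) n [])) atTop (𝓝 q)) :
    p + h * Real.log s ≤ q :=
  le_of_tendsto_of_tendsto' (tendsto_div_add_linear (h * Real.log A) _ hp) hq fun n =>
    mul_le_mul_of_nonneg_left (le_log_levelSum_rpow hd hA hs hle hh n) (by positivity)

omit [Nonempty I] in
/-- A quasi-multiplicative function is bounded from below by a geometric sequence in the length of
the word. -/
theorem QuasiMult.exists_geometric_le {Q : ℝ} (hd : QuasiMult d Q) :
    ∃ r : ℝ, 0 < r ∧ ∀ w, d [] * r ^ w.length ≤ d w := by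
  obtain ⟨c, hc, hcd⟩ : ∃ c : ℝ, 0 < c ∧ ∀ i : I, c ≤ d [i] := by
    rcases isEmpty_or_nonempty I with hI | hI
    · exact ⟨1, one_pos, fun i => isEmptyElim i⟩
    · obtain ⟨i, hi⟩ := Finite.exists_min fun i : I => d [i]
      exact ⟨_, hd.pos _, hi⟩
  have hQ : 0 < Q := zero_lt_one.trans_le hd.one_le
  refine ⟨c / Q, by positivity, fun w => ?_⟩
  induction w with
  | nil => simp
  | cons i w ih =>
    have h0 := hd.pos []
    rw [List.length_cons, pow_succ, ← mul_assoc, ← mul_div_assoc, div_le_iff₀ hQ]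
    calc d [] * (c / Q) ^ w.length * c ≤ d w * d [i] :=
          mul_le_mul ih (hcd i) hc.le (hd.pos w).le
      _ = d [i] * d w := mul_comm _ _
      _ ≤ Q * d ([i] ++ w) := hd.le_append _ _
      _ = d (i :: w) * Q := mul_comm _ _

/-- The pressure of a quasi-multiplicative function with geometric decay is Lipschitz continuous
and strictly decreasing, it is positive at `0` and negative for large exponents; hence it has
exactly one zero. -/
theorem QuasiMult.existsUnique_pressure_zero {Q : ℝ} (hd : QuasiMult d Q)
    (hI : 2 ≤ Fintype.card I) (hA : 0 < A) (hs : 0 < s) (hs1 : s < 1)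
    (hle : ∀ w, d w ≤ A * s ^ w.length) :
    ∃! t : ℝ, 0 ≤ t ∧ Tendsto (fun n : ℕ => (1 / (n : ℝ)) *
      Real.log (levelSum (fun w => d w ^ t) n [])) atTop (𝓝 0) := by
  obtain ⟨r, hr, hrd⟩ := hd.exists_geometric_le
  have hlogs : Real.log s < 0 := Real.log_neg hs hs1
  have hP : ∀ t : ℝ, ∃ p, 0 ≤ t → Tendsto (fun n : ℕ => (1 / (n : ℝ)) *
      Real.log (levelSum (fun w => d w ^ t) n [])) atTop (𝓝 p) := by
    intro t
    by_cases ht : 0 ≤ t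
    · obtain ⟨p, hp⟩ := (hd.rpow ht).exists_tendsto_log
      exact ⟨p, fun _ => hp⟩
    · exact ⟨0, fun h => absurd h ht⟩
  choose P hP using hP
  have upper : ∀ t h : ℝ, 0 ≤ t → 0 ≤ h → P (t + h) ≤ P t + h * Real.log s := fun t h ht hh =>
    pressure_add_le hd.pos hA hs hle hh (hP t ht) (hP _ (by positivity))
  have lower : ∀ t h : ℝ, 0 ≤ t → 0 ≤ h → P t + h * Real.log r ≤ P (t + h) := fun t h ht hh =>
    le_pressure_add hd.pos (hd.pos []) hr hrd hh (hP t ht) (hP _ (by positivity))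
  have lip : ∀ x y : ℝ, 0 ≤ x → x ≤ y → |P x - P y| ≤ |Real.log r| * |x - y| := by
    intro x y hx hxy
    have h1 := upper x (y - x) hx (by linarith)
    have h2 := lower x (y - x) hx (by linarith)
    rw [add_sub_cancel] at h1 h2
    have h3 : (y - x) * Real.log s ≤ 0 := mul_nonpos_of_nonneg_of_nonpos (by linarith) hlogs.le
    have h4 := mul_le_mul_of_nonneg_left (neg_abs_le (Real.log r)) (sub_nonneg.2 hxy)
    rw [abs_of_nonneg (by linarith : 0 ≤ P x - P y), abs_sub_comm x y,
      abs_of_nonneg (sub_nonneg.2 hxy)]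
    linarith
  have hcont : ContinuousOn P (Ici 0) := by
    have : LipschitzOnWith (Real.nnabs (Real.log r)) P (Ici 0) := by
      refine LipschitzOnWith.of_dist_le_mul fun x hx y hy => ?_
      rw [Real.dist_eq, Real.dist_eq, Real.coe_nnabs]
      rcases le_total x y with hxy | hxy
      · exact lip x y hx hxy
      · rw [abs_sub_comm (P x), abs_sub_comm x]
        exact lip y x hy hxy
    exact this.continuousOn
  have h0 : 0 < P 0 := by
    have e := tendsto_nhds_unique (hP 0 le_rfl) (by simpa using tendsto_log_levelSum_one (I := I))
    rw [e]
    exact Real.log_pos (by exact_mod_cast hI)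
  have hT : 0 ≤ P 0 / -Real.log s := div_nonneg h0.le (by linarith)
  have hPT : P (P 0 / -Real.log s) ≤ 0 := by
    have := upper 0 _ le_rfl hT
    rw [zero_add] at this
    refine this.trans_eq ?_
    rw [div_neg, neg_mul, div_mul_cancel₀ _ hlogs.ne, add_neg_cancel]
  obtain ⟨t, ht, hPt⟩ := intermediate_value_Icc' hT (hcont.mono fun x hx => hx.1) ⟨hPT, h0.le⟩
  refine ⟨t, ⟨ht.1, hPt ▸ hP t ht.1⟩, ?_⟩
  rintro u ⟨hu0, hu⟩
  have hPu : P u = 0 := tendsto_nhds_unique (hP u hu0) hu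
  by_contra hne
  rcases lt_or_gt_of_ne hne with hlt | hlt
  · have := upper u (t - u) hu0 (by linarith)
    rw [add_sub_cancel, hPt, hPu] at this
    nlinarith
  · have := upper t (u - t) ht.1 (by linarith)
    rw [add_sub_cancel, hPt, hPu] at this
    nlinarith

omit [Nonempty I] in
theorem pos_of_pressure_zero (hI : 2 ≤ Fintype.card I) (ht : 0 ≤ t)
    (h : Tendsto (fun n : ℕ => (1 / (n : ℝ)) *
      Real.log (levelSum (fun w => d w ^ t) n [])) atTop (𝓝 0)) : 0 < t := by
  refine ht.lt_of_ne ?_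
  rintro rfl
  have e := tendsto_nhds_unique h (by simpa using tendsto_log_levelSum_one (I := I))
  have : 0 < Real.log (Fintype.card I) := Real.log_pos (by exact_mod_cast hI)
  exact this.ne e

end Pressure

/-! ### Finite antichains of words -/

section Antichains

variable {I : Type*}

/-- No word of `W` is an initial segment of another one. -/
def PrefixFree (W : Set (List I)) : Prop :=
  W.Pairwise fun v w => ¬ v <+: w

theorem PrefixFree.eq {W : Set (List I)} (h : PrefixFree W) {v w : List I} (hv : v ∈ W)
    (hw : w ∈ W) (hvw : v <+: w) : v = w := by
  by_contra hne
  exact h hv hw hne hvw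

open Classical in
/-- The tails of those words of `W` that begin with the letter `i`. -/
noncomputable def tails (W : Finset (List I)) (i : I) : Finset (List I) :=
  W.preimage (List.cons i) (List.cons_injective.injOn)

@[simp]
theorem mem_tails {W : Finset (List I)} {i : I} {w : List I} : w ∈ tails W i ↔ i :: w ∈ W := by
  simp [tails]

theorem PrefixFree.tails {W : Finset (List I)} (h : PrefixFree (W : Set (List I))) (i : I) :
    PrefixFree (tails W i : Set (List I)) := by
  intro v hv w hw hne hvw
  simp only [Finset.mem_coe, mem_tails] at hv hw
  exact h hv hw (by simpa using hne) (by simpa using hvw)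

theorem PrefixFree.eq_singleton_nil {W : Finset (List I)} (h : PrefixFree (W : Set (List I)))
    (hW : [] ∈ W) : W = {[]} := by
  ext w
  simp only [Finset.mem_singleton]
  exact ⟨fun hw => (h.eq hW hw List.nil_prefix).symm, fun e => e ▸ hW⟩

theorem sum_eq_sum_tails [Fintype I] {W : Finset (List I)} (hW : [] ∉ W) (f : List I → ℝ) :
    ∑ w ∈ W, f w = ∑ i, ∑ w ∈ tails W i, f (i :: w) := by
  classical
  have e : W = Finset.univ.biUnion fun i => (tails W i).map ⟨List.cons i, List.cons_injective⟩ := by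
    ext w
    simp only [Finset.mem_biUnion, Finset.mem_univ, true_and, Finset.mem_map, mem_tails,
      Function.Embedding.coeFn_mk]
    constructor
    · intro hw
      cases w with
      | nil => exact absurd hw hW
      | cons i w => exact ⟨i, w, hw, rfl⟩
    · rintro ⟨i, v, hv, rfl⟩
      exact hv
  conv_lhs => rw [e]
  rw [Finset.sum_biUnion]
  · simp
  · intro i _ j _ hij
    simp only [Function.onFun, Finset.disjoint_left, Finset.mem_map, Function.Embedding.coeFn_mk]
    rintro _ ⟨v, _, rfl⟩ ⟨w, _, hw⟩
    exact hij (List.cons.inj hw).1.symm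

/-- If every word of length `n` begins with a word from `W`, then the cylinders of the words of `W`
cover everything, and so their total mass is at least the total mass. -/
theorem le_sum_of_covers [Fintype I] {m : List I → ℝ} (hm : ∀ w, m w = ∑ i, m (w ++ [i]))
    (hm0 : ∀ w, 0 ≤ m w) (n : ℕ) (W : Finset (List I))
    (hW : ∀ v : List I, v.length = n → ∃ w ∈ W, w <+: v) (p : List I) :
    m p ≤ ∑ w ∈ W, m (p ++ w) := by
  have nil : ∀ (W : Finset (List I)) (p : List I), [] ∈ W → m p ≤ ∑ w ∈ W, m (p ++ w) :=
    fun W p h => by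
      simpa using Finset.single_le_sum (f := fun w => m (p ++ w)) (fun w _ => hm0 _) h
  induction n generalizing W p with
  | zero =>
    obtain ⟨w, hw, hw'⟩ := hW [] rfl
    rw [List.prefix_nil] at hw'
    exact nil W p (hw' ▸ hw)
  | succ n ih =>
    by_cases h : [] ∈ W
    · exact nil W p h
    rw [sum_eq_sum_tails h, hm p]
    refine Finset.sum_le_sum fun i _ => ?_
    have := ih (tails W i) (fun v hv => ?_) (p ++ [i])
    · simpa using this
    · obtain ⟨w, hw, hwv⟩ := hW (i :: v) (by simp [hv])
      cases w with
      | nil => exact absurd hw h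
      | cons j w =>
        obtain ⟨rfl, hwv'⟩ := List.cons_prefix_cons.1 hwv
        exact ⟨w, mem_tails.2 hw, hwv'⟩

theorem sum_biUnion_le {κ : Type*} [DecidableEq (List I)] (T : Finset κ)
    (Z : κ → Finset (List I)) {m : List I → ℝ} (hm : ∀ w, 0 ≤ m w) :
    ∑ w ∈ T.biUnion Z, m w ≤ ∑ p ∈ T, ∑ w ∈ Z p, m w := by
  classical
  induction T using Finset.induction_on with
  | empty => simp
  | insert p T hp ih =>
    rw [Finset.biUnion_insert, Finset.sum_insert hp]
    have h1 := Finset.sum_union_inter (s₁ := Z p) (s₂ := T.biUnion Z) (f := m)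
    have h2 : 0 ≤ ∑ w ∈ Z p ∩ T.biUnion Z, m w := Finset.sum_nonneg fun w _ => hm w
    linarith

end Antichains

/-! ### Incomparable words -/

section Incomparability

variable {I : Type*}

theorem initialSegment_length (u : ℕ → I) (n : ℕ) : (initialSegment u n).length = n := by
  simp [initialSegment]

theorem initialSegment_succ (u : ℕ → I) (n : ℕ) :
    initialSegment u (n + 1) = initialSegment u n ++ [u n] := by
  rw [initialSegment, List.ofFn_succ_last]
  rfl

theorem initialSegment_prefix (u : ℕ → I) {m n : ℕ} (h : m ≤ n) :
    initialSegment u m <+: initialSegment u n := by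
  induction n, h using Nat.le_induction with
  | base => exact List.prefix_rfl
  | succ n _ ih => exact ih.trans (initialSegment_succ u n ▸ List.prefix_append _ _)

theorem mem_cylinder_getD (i : I) (w : List I) : (fun n => w.getD n i) ∈ cylinder w := by
  refine List.ext_getElem (initialSegment_length _ _) fun n h1 h2 => ?_
  simp [initialSegment]

theorem cylinder_anti {v w : List I} (h : v <+: w) : cylinder w ⊆ cylinder v := by
  intro u hu
  have h1 : initialSegment u v.length <+: w := by
    have := initialSegment_prefix u h.length_le
    rwa [show initialSegment u w.length = w from hu] at this
  exact (List.prefix_of_prefix_length_le h1 h (initialSegment_length _ _).le).eq_of_length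
    (initialSegment_length _ _)

theorem incomparable_iff [Nonempty I] {v w : List I} :
    Incomparable v w ↔ ¬ v <+: w ∧ ¬ w <+: v := by
  inhabit I
  constructor
  · rintro ⟨_, _, h⟩
    constructor
    · intro hvw
      exact disjoint_left.1 h (cylinder_anti hvw (mem_cylinder_getD default w))
        (mem_cylinder_getD default w)
    · intro hvw
      exact disjoint_left.1 h (mem_cylinder_getD default v)
        (cylinder_anti hvw (mem_cylinder_getD default v))
  · rintro ⟨h1, h2⟩
    refine ⟨fun e => h1 (e ▸ List.nil_prefix), fun e => h2 (e ▸ List.nil_prefix), ?_⟩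
    rw [disjoint_left]
    intro u hv hw
    have ev : initialSegment u v.length = v := hv
    have ew : initialSegment u w.length = w := hw
    rcases le_total v.length w.length with h | h
    · exact h1 (ev ▸ ew ▸ initialSegment_prefix u (by simpa [initialSegment_length] using h))
    · exact h2 (ev ▸ ew ▸ initialSegment_prefix u (by simpa [initialSegment_length] using h))

end Incomparability

/-! ### Geometry of the pieces -/

section Pieces

variable {I M : Type*} [MetricSpace M]

theorem _root_.Metric.diam_image_le_mul {f : M → M} {s : Set M} {c : ℝ} (hc : 0 ≤ c)
    (hs : Bornology.IsBounded s) (h : ∀ x y, dist (f x) (f y) ≤ c * dist x y) :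
    Metric.diam (f '' s) ≤ c * Metric.diam s := by
  refine Metric.diam_le_of_forall_dist_le (mul_nonneg hc Metric.diam_nonneg) ?_
  rintro _ ⟨x, hx, rfl⟩ _ ⟨y, hy, rfl⟩
  exact (h x y).trans (mul_le_mul_of_nonneg_left (Metric.dist_le_diam_of_mem hs hx hy) hc)

theorem _root_.Metric.mul_diam_le_diam_image {f : M → M} {s : Set M} {c : ℝ} (hc : 0 < c)
    (hs : Bornology.IsBounded (f '' s)) (h : ∀ x y, c * dist x y ≤ dist (f x) (f y)) :
    c * Metric.diam s ≤ Metric.diam (f '' s) := by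
  rw [mul_comm, ← le_div_iff₀ hc]
  refine Metric.diam_le_of_forall_dist_le (div_nonneg Metric.diam_nonneg hc.le) fun x hx y hy => ?_
  rw [le_div_iff₀ hc, mul_comm]
  exact (h x y).trans
    (Metric.dist_le_diam_of_mem hs (mem_image_of_mem f hx) (mem_image_of_mem f hy))

namespace IFS

theorem wordMap_append (F : IFS I M) (v w : List I) (x : M) :
    F.wordMap (v ++ w) x = F.wordMap v (F.wordMap w x) := by
  induction v with
  | nil => rfl
  | cons i v ih => simp [wordMap, ih]

theorem wordMap_singleton (F : IFS I M) (i : I) : F.wordMap [i] = F.map i := rfl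

theorem pieces_nil (F : IFS I M) (E : Set M) : F.pieces E [] = E := image_id E

theorem pieces_append (F : IFS I M) (E : Set M) (v w : List I) :
    F.pieces E (v ++ w) = F.wordMap v '' F.pieces E w := by
  simp only [pieces, image_image, wordMap_append]

/-- The diameter of the set `φ_w(E)`. -/
noncomputable def pieceDiam (F : IFS I M) (E : Set M) (w : List I) : ℝ :=
  Metric.diam (F.pieces E w)

/-- The compact set `E` is invariant under `F`, and each `φ_w`, including the identity `φ_∅`,
scales distances by `diam φ_w(E)` up to the factor `Q`. Semiconformality is used in this form. -/
structure ConformalBounds (F : IFS I M) (E : Set M) (Q : ℝ) : Prop where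
  nonempty : E.Nonempty
  isCompact : IsCompact E
  eq_iUnion : E = ⋃ i, F.map i '' E
  one_le : 1 ≤ Q
  diam_pos : ∀ w, 0 < F.pieceDiam E w
  dist_le : ∀ w x y, dist (F.wordMap w x) (F.wordMap w y) ≤ Q * F.pieceDiam E w * dist x y
  le_dist : ∀ w x y, F.pieceDiam E w * dist x y ≤ Q * dist (F.wordMap w x) (F.wordMap w y)

theorem IsSemiconformal.exists_conformalBounds {F : IFS I M} {E : Set M} {D : ℝ}
    {lo hi : List I → ℝ} (hF : F.IsSemiconformal E D lo hi) (hE : F.IsInvariantSet E) :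
    ∃ Q, F.ConformalBounds E Q ∧
      ∀ w, w ≠ [] → lo w ≤ Q * F.pieceDiam E w ∧ F.pieceDiam E w ≤ Q * lo w := by
  obtain ⟨hδ, hD, hw⟩ := hF
  obtain ⟨hne, hcpt, hinv⟩ := hE
  set δ := Metric.diam E with hδdef
  have hδi : 0 < δ⁻¹ := inv_pos.2 hδ
  have hnil : F.pieceDiam E [] = δ := by rw [pieceDiam, pieces_nil]
  have lower : ∀ w, w ≠ [] → lo w * δ ≤ F.pieceDiam E w := fun w hwn => by
    obtain ⟨h1, h2, h3, h4, h5⟩ := hw w hwn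
    have hlip : LipschitzWith (Real.toNNReal (hi w)) (F.wordMap w) :=
      LipschitzWith.of_dist_le_mul fun x y => by
        rw [Real.coe_toNNReal _ (h1.trans_le h2).le]
        exact (h5 x y).2
    exact Metric.mul_diam_le_diam_image h1 (hcpt.image hlip.continuous).isBounded
      fun x y => (h5 x y).1
  have upper : ∀ w, w ≠ [] → F.pieceDiam E w ≤ hi w * δ := fun w hwn => by
    obtain ⟨h1, h2, h3, h4, h5⟩ := hw w hwn
    exact Metric.diam_image_le_mul (h1.trans_le h2).le hcpt.isBounded fun x y => (h5 x y).2
  have e1 : 2 ≤ δ + δ⁻¹ := by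
    have : δ * δ⁻¹ = 1 := mul_inv_cancel₀ hδ.ne'
    nlinarith [sq_nonneg (δ - δ⁻¹)]
  have hQ1 : D * δ⁻¹ ≤ D * (δ + δ⁻¹) := by gcongr; linarith
  have hQ2 : D * δ ≤ D * (δ + δ⁻¹) := by gcongr; linarith
  have hQ3 : δ⁻¹ ≤ D * (δ + δ⁻¹) := by nlinarith
  have lo_le : ∀ w, w ≠ [] → lo w ≤ δ⁻¹ * F.pieceDiam E w := fun w hwn => by
    rw [← div_eq_inv_mul, le_div_iff₀ hδ]
    exact lower w hwn
  refine ⟨D * (δ + δ⁻¹), ⟨hne, hcpt, hinv, by nlinarith, fun w => ?_, fun w x y => ?_,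
    fun w x y => ?_⟩, fun w hwn => ⟨?_, ?_⟩⟩
  · rcases eq_or_ne w [] with rfl | hwn
    · rwa [hnil]
    · exact (mul_pos (hw w hwn).1 hδ).trans_le (lower w hwn)
  · rcases eq_or_ne w [] with rfl | hwn
    · rw [hnil]
      have : δ⁻¹ * δ = 1 := inv_mul_cancel₀ hδ.ne'
      have h1 : 1 ≤ D * (δ + δ⁻¹) * δ := by nlinarith
      simpa [wordMap] using le_mul_of_one_le_left dist_nonneg h1
    · obtain ⟨h1, h2, h3, h4, h5⟩ := hw w hwn
      have hd : 0 ≤ F.pieceDiam E w := Metric.diam_nonneg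
      calc dist (F.wordMap w x) (F.wordMap w y) ≤ hi w * dist x y := (h5 x y).2
        _ ≤ D * (δ⁻¹ * F.pieceDiam E w) * dist x y := by
            gcongr
            exact h4.trans (by gcongr; exact lo_le w hwn)
        _ ≤ D * (δ + δ⁻¹) * F.pieceDiam E w * dist x y := by
            rw [← mul_assoc]
            gcongr
  · rcases eq_or_ne w [] with rfl | hwn
    · rw [hnil]
      simp only [wordMap, id]
      gcongr
      nlinarith
    · obtain ⟨h1, h2, h3, h4, h5⟩ := hw w hwn
      calc F.pieceDiam E w * dist x y ≤ (D * lo w * δ) * dist x y := by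
            gcongr
            exact (upper w hwn).trans (by gcongr)
        _ = D * δ * (lo w * dist x y) := by ring
        _ ≤ D * (δ + δ⁻¹) * dist (F.wordMap w x) (F.wordMap w y) := by
            gcongr
            exact (h5 x y).1
  · refine (lo_le w hwn).trans ?_
    gcongr
    exact Metric.diam_nonneg
  · obtain ⟨h1, h2, h3, h4, h5⟩ := hw w hwn
    calc F.pieceDiam E w ≤ hi w * δ := upper w hwn
      _ ≤ D * lo w * δ := by gcongr
      _ = D * δ * lo w := by ring
      _ ≤ _ := by gcongr

namespace ConformalBounds

variable {F : IFS I M} {E : Set M} {Q : ℝ}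

theorem Q_pos (h : F.ConformalBounds E Q) : 0 < Q := zero_lt_one.trans_le h.one_le

theorem continuous_wordMap (h : F.ConformalBounds E Q) (w : List I) :
    Continuous (F.wordMap w) := by
  have hc : 0 ≤ Q * F.pieceDiam E w := (mul_pos h.Q_pos (h.diam_pos w)).le
  exact (LipschitzWith.of_dist_le_mul (K := Real.toNNReal (Q * F.pieceDiam E w)) fun x y => by
    rw [Real.coe_toNNReal _ hc]; exact h.dist_le w x y).continuous

theorem isCompact_pieces (h : F.ConformalBounds E Q) (w : List I) : IsCompact (F.pieces E w) :=
  h.isCompact.image (h.continuous_wordMap w)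

theorem pieces_nonempty (h : F.ConformalBounds E Q) (w : List I) : (F.pieces E w).Nonempty :=
  h.nonempty.image _

theorem dist_le_pieceDiam (h : F.ConformalBounds E Q) {w : List I} {x y : M}
    (hx : x ∈ F.pieces E w) (hy : y ∈ F.pieces E w) : dist x y ≤ F.pieceDiam E w :=
  Metric.dist_le_diam_of_mem (h.isCompact_pieces w).isBounded hx hy

theorem pieces_eq_iUnion (h : F.ConformalBounds E Q) (w : List I) :
    F.pieces E w = ⋃ i, F.pieces E (w ++ [i]) := by
  simp only [pieces_append, ← image_iUnion]
  conv_lhs => rw [pieces, h.eq_iUnion]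
  rfl

theorem pieces_subset (h : F.ConformalBounds E Q) {v w : List I} (hvw : v <+: w) :
    F.pieces E w ⊆ F.pieces E v := by
  obtain ⟨u, rfl⟩ := hvw
  induction u using List.reverseRecOn with
  | nil => simp
  | append_singleton u i ih =>
    rw [← List.append_assoc]
    refine Subset.trans ?_ ih
    rw [h.pieces_eq_iUnion (v ++ u)]
    exact subset_iUnion (fun i => F.pieces E (v ++ u ++ [i])) i

theorem pieces_subset_self (h : F.ConformalBounds E Q) (w : List I) : F.pieces E w ⊆ E := by
  have := h.pieces_subset (List.nil_prefix (l := w))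
  rwa [pieces_nil] at this

theorem pieceDiam_anti (h : F.ConformalBounds E Q) {v w : List I} (hvw : v <+: w) :
    F.pieceDiam E w ≤ F.pieceDiam E v :=
  Metric.diam_mono (h.pieces_subset hvw) (h.isCompact_pieces v).isBounded

theorem quasiMult (h : F.ConformalBounds E Q) : QuasiMult (F.pieceDiam E) Q where
  one_le := h.one_le
  pos := h.diam_pos
  append_le v w := by
    rw [pieceDiam, pieces_append, ← mul_assoc]
    exact Metric.diam_image_le_mul (mul_pos h.Q_pos (h.diam_pos v)).le
      (h.isCompact_pieces w).isBounded (h.dist_le v)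
  le_append v w := by
    have := Metric.mul_diam_le_diam_image (s := F.pieces E w) (f := F.wordMap v)
      (div_pos (h.diam_pos v) h.Q_pos)
      ((h.isCompact_pieces w).image (h.continuous_wordMap v)).isBounded fun x y => by
        rw [div_mul_eq_mul_div, div_le_iff₀ h.Q_pos, mul_comm _ Q]
        exact h.le_dist v x y
    rw [div_mul_eq_mul_div, div_le_iff₀ h.Q_pos, mul_comm _ Q, ← pieces_append] at this
    exact this

variable [Fintype I]

omit [Fintype I] in
theorem nonempty_index (h : F.ConformalBounds E Q) : Nonempty I := by
  obtain ⟨x, hx⟩ := h.nonempty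
  rw [h.eq_iUnion] at hx
  exact ⟨(mem_iUnion.1 hx).choose⟩

theorem exists_geometric_bound (h : F.ConformalBounds E Q) :
    ∃ s : ℝ, 0 < s ∧ s < 1 ∧ ∀ w, F.pieceDiam E w ≤ F.pieceDiam E [] * s ^ w.length := by
  have := h.nonempty_index
  choose s hs0 hs1 hs using F.contractive
  obtain ⟨i, hi⟩ := Finite.exists_max s
  refine ⟨s i, hs0 i, hs1 i, fun w => ?_⟩
  induction w with
  | nil => simp
  | cons j w ih =>
    have hb : F.pieceDiam E (j :: w) ≤ s i * F.pieceDiam E w := by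
      have e : F.pieces E (j :: w) = F.map j '' F.pieces E w := F.pieces_append E [j] w
      rw [pieceDiam, e]
      exact Metric.diam_image_le_mul (hs0 i).le (h.isCompact_pieces w).isBounded fun x y =>
        (hs j x y).trans (mul_le_mul_of_nonneg_right (hi j) dist_nonneg)
    refine hb.trans ?_
    rw [List.length_cons, pow_succ, ← mul_assoc, mul_comm (s i)]
    exact mul_le_mul_of_nonneg_right ih (hs0 i).le

/-- The diameters of all pieces of a sufficiently high level are small. -/
theorem exists_level (h : F.ConformalBounds E Q) {r : ℝ} (hr : 0 < r) :
    ∃ n : ℕ, ∀ w : List I, n ≤ w.length → F.pieceDiam E w < r := by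
  obtain ⟨s, hs0, hs1, hs⟩ := h.exists_geometric_bound
  obtain ⟨n, hn⟩ := exists_pow_lt_of_lt_one (div_pos hr (h.diam_pos [])) hs1
  refine ⟨n, fun w hw => ?_⟩
  rw [lt_div_iff₀ (h.diam_pos []), mul_comm] at hn
  refine (hs w).trans_lt (lt_of_le_of_lt ?_ hn)
  gcongr _ * ?_
  · exact (h.diam_pos []).le
  · exact pow_le_pow_of_le_one hs0.le hs1.le hw

theorem exists_ratio (h : F.ConformalBounds E Q) :
    ∃ ρ : ℝ, 0 < ρ ∧ ρ ≤ 1 ∧ ∀ w i, ρ * F.pieceDiam E w ≤ F.pieceDiam E (w ++ [i]) := by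
  have := h.nonempty_index
  obtain ⟨i, hi⟩ := Finite.exists_min fun i : I => F.pieceDiam E [i]
  have key : ∀ w j, F.pieceDiam E [i] / Q * F.pieceDiam E w ≤ F.pieceDiam E (w ++ [j]) := by
    intro w j
    rw [div_mul_eq_mul_div, div_le_iff₀ h.Q_pos, mul_comm, mul_comm _ Q]
    exact (mul_le_mul_of_nonneg_left (hi j) (h.diam_pos w).le).trans
      (h.quasiMult.le_append w [j])
  refine ⟨F.pieceDiam E [i] / Q, div_pos (h.diam_pos _) h.Q_pos, ?_, key⟩
  exact le_of_mul_le_mul_right (((key [] i).trans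
    (h.pieceDiam_anti (List.prefix_append _ _))).trans_eq (one_mul _).symm) (h.diam_pos [])

theorem isWCMC (h : F.ConformalBounds E Q) : IsWCMC (F.pieces E) := by
  obtain ⟨ρ, hρ, -, hρd⟩ := h.exists_ratio
  have hD : 0 < max Q ρ⁻¹ := lt_max_of_lt_left h.Q_pos
  refine ⟨fun w => ⟨h.isCompact_pieces w, h.diam_pos w⟩, max Q ρ⁻¹, le_max_of_le_left h.one_le,
    fun w _ => h.pieces_subset w.dropLast_prefix, ?_, fun v w _ _ => ?_, fun w hw => ?_⟩
  · obtain ⟨n, hn⟩ := h.exists_level (inv_pos.2 hD)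
    exact ⟨n + 1, by omega, fun w hw => hn w (by omega)⟩
  · refine (h.quasiMult.append_le v w).trans ?_
    rw [mul_assoc]
    exact mul_le_mul_of_nonneg_right (le_max_left _ _)
      (mul_pos (h.diam_pos v) (h.diam_pos w)).le
  · have e : (max Q ρ⁻¹)⁻¹ ≤ ρ := inv_le_of_inv_le₀ hρ (le_max_right _ _)
    refine (mul_le_mul_of_nonneg_right e Metric.diam_nonneg).trans ?_
    have := hρd w.dropLast (w.getLast hw)
    rwa [List.dropLast_append_getLast hw] at this

omit [Fintype I] in
theorem limitSet_eq (h : F.ConformalBounds E Q) : limitSet (F.pieces E) = E := by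
  ext x
  constructor
  · rintro ⟨u, hu⟩
    exact h.pieces_subset_self _ (hu 1 le_rfl)
  · intro hx
    have step : ∀ y : E, ∃ p : I × E, F.map p.1 p.2 = y := by
      rintro ⟨y, hy⟩
      rw [h.eq_iUnion] at hy
      obtain ⟨i, z, hz, rfl⟩ := mem_iUnion.1 hy
      exact ⟨(i, ⟨z, hz⟩), rfl⟩
    choose g hg using step
    -- the orbit of `x` under the chosen inverse branches; the letters used form an address of `x`
    let z : ℕ → E := fun n => (fun y => (g y).2)^[n] ⟨x, hx⟩
    refine ⟨fun n => (g (z n)).1, fun n _ => ⟨z n, (z n).2, ?_⟩⟩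
    induction n with
    | zero => rfl
    | succ n ih =>
      rw [initialSegment_succ, wordMap_append, wordMap_singleton]
      have : z (n + 1) = (g (z n)).2 := by
        simp only [z, Function.iterate_succ_apply']
      rw [this, hg]
      rcases Nat.eq_zero_or_pos n with rfl | hn
      · rfl
      · exact ih hn

/-! ### Stopping words -/

/-- Every word `w` with `x ∈ φ_w(E)` can be extended to a word of diameter comparable to `η` whose
piece still contains `x`. -/
theorem exists_extension (h : F.ConformalBounds E Q) {ρ : ℝ} (hρ : 0 < ρ) (hρ1 : ρ ≤ 1)
    (hρd : ∀ w i, ρ * F.pieceDiam E w ≤ F.pieceDiam E (w ++ [i])) {η : ℝ} (hη : 0 < η)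
    {w : List I} {x : M} (hx : x ∈ F.pieces E w) (hw : η ≤ F.pieceDiam E w) :
    ∃ v, w <+: v ∧ x ∈ F.pieces E v ∧ F.pieceDiam E v ≤ η ∧ ρ * η ≤ F.pieceDiam E v := by
  obtain ⟨N, hN⟩ := h.exists_level hη
  have key : ∀ n : ℕ, ∀ w, N ≤ w.length + n → x ∈ F.pieces E w → ρ * η ≤ F.pieceDiam E w →
      ∃ v, w <+: v ∧ x ∈ F.pieces E v ∧ F.pieceDiam E v ≤ η ∧ ρ * η ≤ F.pieceDiam E v := by
    intro n
    induction n with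
    | zero => exact fun w hw hx hd => ⟨w, List.prefix_rfl, hx, (hN w hw).le, hd⟩
    | succ n ih =>
      intro w hw hx hd
      by_cases hle : F.pieceDiam E w ≤ η
      · exact ⟨w, List.prefix_rfl, hx, hle, hd⟩
      rw [h.pieces_eq_iUnion w] at hx
      obtain ⟨i, hi⟩ := mem_iUnion.1 hx
      obtain ⟨v, hv, hv'⟩ := ih (w ++ [i]) (by simp; omega) hi
        ((mul_le_mul_of_nonneg_left (not_le.1 hle).le hρ.le).trans (hρd w i))
      exact ⟨v, (List.prefix_append w [i]).trans hv, hv'⟩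
  exact key N w (by omega) hx ((mul_le_of_le_one_left hη.le hρ1).trans hw)

omit [Fintype I] in
theorem exists_prefix_stopping {r : ℝ} {v : List I}
    (hr : r < F.pieceDiam E []) (hv : F.pieceDiam E v ≤ r) :
    ∃ w, w <+: v ∧ w ∈ stopping (F.pieces E) r := by
  induction v using List.reverseRecOn with
  | nil => exact absurd hv (not_le.2 hr)
  | append_singleton v i ih =>
    by_cases hle : F.pieceDiam E v ≤ r
    · obtain ⟨w, hw, hw'⟩ := ih hle
      exact ⟨w, hw.trans (List.prefix_append _ _), hw'⟩
    · refine ⟨v ++ [i], List.prefix_rfl, by simp, hv, ?_⟩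
      rw [List.dropLast_concat]
      exact not_le.1 hle

omit [Fintype I] in
theorem prefixFree_stopping (h : F.ConformalBounds E Q) (r : ℝ) :
    PrefixFree (stopping (F.pieces E) r) := by
  intro v hv w hw hne hvw
  have : v <+: w.dropLast := by
    obtain ⟨u, rfl⟩ := hvw
    have hu : u ≠ [] := by
      rintro rfl
      simp at hne
    rw [List.dropLast_append_of_ne_nil hu]
    exact List.prefix_append _ _
  exact absurd ((h.pieceDiam_anti this).trans hv.2.1) (not_le.2 hw.2.2)

omit [Fintype I] in
theorem le_pieceDiam_of_mem_stopping {ρ : ℝ} (hρ : 0 < ρ)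
    (hρd : ∀ w i, ρ * F.pieceDiam E w ≤ F.pieceDiam E (w ++ [i])) {r : ℝ} {w : List I}
    (hw : w ∈ stopping (F.pieces E) r) : ρ * r ≤ F.pieceDiam E w := by
  have := hρd w.dropLast (w.getLast hw.1)
  rw [List.dropLast_append_getLast hw.1] at this
  exact (mul_le_mul_of_nonneg_left hw.2.2.le hρ.le).trans this

end ConformalBounds

end IFS

end Pieces

end Moran

/-! ### Separated families in doubling spaces -/

theorem IsDoublingSpace.exists_cover {M : Type*} [MetricSpace M] (hM : IsDoublingSpace M)
    (k : ℕ) : ∃ K : ℕ, ∀ (x : M) (r : ℝ), 0 < r → ∃ C : Finset M, C.card ≤ K ∧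
      Metric.ball x (2 ^ k * r) ⊆ ⋃ y ∈ C, Metric.ball y r := by
  classical
  induction k with
  | zero => exact ⟨1, fun x r _ => ⟨{x}, by simp, by simp⟩⟩
  | succ k ih =>
    obtain ⟨K, hK⟩ := ih
    obtain ⟨κ, hκ⟩ := hM
    refine ⟨κ * K, fun x r hr => ?_⟩
    obtain ⟨C, hC, hCx⟩ := hκ x (2 ^ k * r) (by positivity)
    choose B hB hBx using fun y => hK y r hr
    refine ⟨C.biUnion B, ?_, fun z hz => ?_⟩
    · exact (Finset.card_biUnion_le_card_mul C B K fun y _ => hB y).trans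
        (Nat.mul_le_mul_right K hC)
    · rw [pow_succ', mul_assoc] at hz
      obtain ⟨y, hy, hzy⟩ := mem_iUnion₂.1 (hCx hz)
      obtain ⟨y', hy', hzy'⟩ := mem_iUnion₂.1 (hBx y hzy)
      exact mem_iUnion₂.2 ⟨y', Finset.mem_biUnion.2 ⟨y, hy, hy'⟩, hzy'⟩

theorem IsDoublingSpace.exists_encard_le {M : Type*} [MetricSpace M] (hM : IsDoublingSpace M)
    (ι : Type*) {θ : ℝ} (hθ : 0 < θ) :
    ∃ N : ℕ, ∀ (x : M) (R : ℝ), 0 < R → ∀ (s : Set ι) (c : ι → M),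
      (∀ i ∈ s, c i ∈ Metric.ball x R) →
      (∀ i ∈ s, ∀ j ∈ s, i ≠ j → θ * R ≤ dist (c i) (c j)) → s.encard ≤ N := by
  obtain ⟨k, hk⟩ := pow_unbounded_of_one_lt (2 / θ) (one_lt_two (α := ℝ))
  obtain ⟨K, hK⟩ := hM.exists_cover k
  refine ⟨K, fun x R hR s c hc hsep => ?_⟩
  have h2 : (0 : ℝ) < 2 ^ k := by positivity
  obtain ⟨C, hC, hCx⟩ := hK x (R / 2 ^ k) (by positivity)
  rw [mul_div_cancel₀ _ h2.ne'] at hCx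
  have hex : ∀ i : ι, ∃ y, i ∈ s → y ∈ C ∧ c i ∈ Metric.ball y (R / 2 ^ k) := fun i => by
    by_cases hi : i ∈ s
    · obtain ⟨y, hy, hy'⟩ := mem_iUnion₂.1 (hCx (hc i hi))
      exact ⟨y, fun _ => ⟨hy, hy'⟩⟩
    · exact ⟨x, fun h => absurd h hi⟩
  choose g hg using hex
  have hinj : InjOn g s := by
    intro i hi j hj hij
    by_contra hne
    have h1 := Metric.mem_ball.1 (hg i hi).2
    have h3 := Metric.mem_ball.1 (hg j hj).2
    rw [← hij] at h3
    have h4 := hsep i hi j hj hne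
    have h5 := dist_triangle_right (c i) (c j) (g i)
    have h6 : 2 * (R / 2 ^ k) ≤ θ * R := by
      rw [div_lt_iff₀ hθ] at hk
      rw [← mul_div_assoc, div_le_iff₀ h2]
      nlinarith
    linarith
  calc s.encard ≤ (C : Set M).encard :=
        encard_le_encard_of_injOn (fun i hi => (hg i hi).1) hinj
    _ = C.card := encard_coe_eq_coe_finsetCard C
    _ ≤ K := by exact_mod_cast hC

namespace Moran

/-! ### Finite clustering, the ball condition, and separated orbits -/

variable {I M : Type*} [MetricSpace M]

theorem finiteClustering_iff {X : List I → Set M} :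
    FiniteClustering X ↔ ∃ N : ℕ, ∀ x ∈ limitSet X,
      ∀ᶠ r : ℝ in 𝓝[>] 0, (localStopping X x r).encard ≤ N := by
  constructor
  · intro h
    obtain ⟨N, hN⟩ := ENat.ne_top_iff_exists.1 h.ne
    refine ⟨N, fun x hx => ?_⟩
    have h1 : limsup (fun r : ℝ => (localStopping X x r).encard) (𝓝[>] 0) ≤ N := by
      rw [hN]
      exact le_iSup₂ (f := fun x (_ : x ∈ limitSet X) =>
        limsup (fun r : ℝ => (localStopping X x r).encard) (𝓝[>] 0)) x hx
    have h2 : (N : ℕ∞) < N + 1 := by exact_mod_cast Nat.lt_succ_self N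
    filter_upwards [eventually_lt_of_limsup_lt (h1.trans_lt h2)] with r hr
    exact (ENat.lt_add_one_iff (ENat.natCast_ne_top N)).1 hr
  · rintro ⟨N, hN⟩
    refine lt_of_le_of_lt (iSup₂_le fun x hx => ?_) (ENat.natCast_lt_top N)
    exact limsup_le_of_le (by isBoundedDefault) (hN x hx)

/-- Disjoint balls of radius `δ r` centred within a bounded multiple of `r` from `x` are bounded in
number. -/
theorem BallCondition.finiteClustering (hM : IsDoublingSpace M) {X : List I → Set M}
    (hX : ∀ w, IsCompact (X w)) (h : BallCondition X) : FiniteClustering X := by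
  obtain ⟨δ, hδ, -, h⟩ := h
  obtain ⟨N, hN⟩ := hM.exists_encard_le (List I) (θ := δ / 3) (by positivity)
  refine finiteClustering_iff.2 ⟨N, fun x hx => ?_⟩
  obtain ⟨rx, hrx, hr⟩ := h x hx
  filter_upwards [Ioo_mem_nhdsGT hrx] with r hr0
  obtain ⟨c, hc, hdisj⟩ := hr r hr0.1 hr0.2
  have hrpos : 0 < r := hr0.1
  refine hN x (3 * r) (by positivity) _ c (fun w hw => ?_) fun v hv w hw hne => ?_
  · obtain ⟨p, hp, hpx⟩ := hw.2
    obtain ⟨q, hq, hqc⟩ := (Metric.infDist_lt_iff ⟨p, hp⟩).1 (hc w hw)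
    have h1 : dist q p ≤ r :=
      (Metric.dist_le_diam_of_mem (hX w).isBounded hq hp).trans hw.1.2.1
    have h2 := Metric.mem_ball.1 hpx
    have h3 := dist_triangle4 (c w) q p x
    rw [Metric.mem_ball]
    linarith
  · by_contra hlt
    have e : δ / 3 * (3 * r) = δ * r := by ring
    rw [e, not_le] at hlt
    exact disjoint_left.1 (hdisj hv hw hne) (Metric.mem_ball_self (by positivity))
      (Metric.mem_ball.2 hlt)

/-- From finitely many families of at least as many separated points one can choose
representatives that are separated: each representative already chosen excludes at most one point
of the next family. -/
theorem exists_separated_choice [Nonempty M] {ι : Type*} {N : ℕ} {θ : ℝ} (p : ι → Fin N → M) (s : Finset ι)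
    (hs : s.card ≤ N) (hp : ∀ i ∈ s, ∀ j k, j ≠ k → 2 * θ ≤ dist (p i j) (p i k)) :
    ∃ f : ι → M, (∀ i ∈ s, f i ∈ range (p i)) ∧
      ∀ i ∈ s, ∀ j ∈ s, i ≠ j → θ ≤ dist (f i) (f j) := by
  classical
  induction s using Finset.induction_on with
  | empty =>
    inhabit M
    exact ⟨fun _ => default, by simp⟩
  | insert i s hi ih =>
    rw [Finset.card_insert_of_notMem hi] at hs
    obtain ⟨f, hf, hfs⟩ := ih (by omega) fun j hj => hp j (Finset.mem_insert_of_mem hj)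
    obtain ⟨k, hk⟩ : ∃ k, ∀ j ∈ s, θ ≤ dist (p i k) (f j) := by
      by_contra! hcon
      choose g hg hgd using hcon
      obtain ⟨j, -, k, -, hjk, he⟩ := Finset.exists_ne_map_eq_of_card_lt_of_maps_to
        (s := (Finset.univ : Finset (Fin N))) (t := s) (by simpa using hs) (f := g)
        fun k _ => hg k
      have h1 := hp i (Finset.mem_insert_self i s) j k hjk
      have h2 := hgd j
      have h3 := hgd k
      rw [← he] at h3
      linarith [dist_triangle_right (p i j) (p i k) (f (g j))]
    refine ⟨Function.update f i (p i k), fun j hj => ?_, fun j hj l hl hne => ?_⟩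
    · rcases eq_or_ne j i with rfl | hji
      · simp
      · rw [Function.update_of_ne hji]
        exact hf j (Finset.mem_of_mem_insert_of_ne hj hji)
    · rcases eq_or_ne j i with rfl | hji
      · rw [Function.update_self, Function.update_of_ne hne.symm]
        exact hk l (Finset.mem_of_mem_insert_of_ne hl hne.symm)
      · rcases eq_or_ne l i with rfl | hli
        · rw [Function.update_self, Function.update_of_ne hji, dist_comm]
          exact hk j (Finset.mem_of_mem_insert_of_ne hj hji)
        · rw [Function.update_of_ne hji, Function.update_of_ne hli]
          exact hfs j (Finset.mem_of_mem_insert_of_ne hj hji) l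
            (Finset.mem_of_mem_insert_of_ne hl hli) hne

namespace IFS.ConformalBounds

variable {F : IFS I M} {E : Set M} {Q : ℝ} [Fintype I]

omit [Fintype I] in
theorem injective_wordMap (h : F.ConformalBounds E Q) (w : List I) :
    Function.Injective (F.wordMap w) := by
  intro x y hxy
  have := h.le_dist w x y
  rw [hxy, dist_self, mul_zero] at this
  exact dist_le_zero.1 (le_of_mul_le_mul_left (by simpa using this) (h.diam_pos w))

/-- If `E` were finite, all pieces would equal `E`, but their diameters tend to zero. -/
theorem infinite (h : F.ConformalBounds E Q) : E.Infinite := by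
  intro hfin
  obtain ⟨n, hn⟩ := h.exists_level (h.diam_pos [])
  obtain ⟨i⟩ := h.nonempty_index
  have h1 := hn (List.replicate n i) (by simp)
  have e : F.pieces E (List.replicate n i) = E :=
    eq_of_subset_of_ncard_le (h.pieces_subset_self _)
      (ncard_image_of_injective E (h.injective_wordMap _)).ge hfin
  rw [pieceDiam, e, pieceDiam, pieces_nil] at h1
  exact h1.false

theorem ballCondition (h : F.ConformalBounds E Q) (hfc : Moran.FiniteClustering (F.pieces E)) :
    Moran.BallCondition (F.pieces E) := by
  obtain ⟨N, hN⟩ := finiteClustering_iff.1 hfc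
  have : Nonempty M := h.nonempty.to_type
  obtain ⟨ρ, hρ, -, hρd⟩ := h.exists_ratio
  have hQ := h.Q_pos
  let p : Fin N → M := fun k => (h.infinite.natEmbedding E k : M)
  have hpE : ∀ k, p k ∈ E := fun k => (h.infinite.natEmbedding E k).2
  have hpinj : Function.Injective p := fun j k hjk =>
    Fin.ext ((h.infinite.natEmbedding E).injective (Subtype.ext hjk))
  obtain ⟨η, hη, hηp⟩ : ∃ η : ℝ, 0 < η ∧ ∀ j k, j ≠ k → η ≤ dist (p j) (p k) := by
    have hev : ∀ᶠ η : ℝ in 𝓝[>] 0, ∀ j k, j ≠ k → η ≤ dist (p j) (p k) := by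
      refine eventually_all.2 fun j => eventually_all.2 fun k => ?_
      by_cases hjk : j = k
      · exact Eventually.of_forall fun _ hne => absurd hjk hne
      · filter_upwards [Ioo_mem_nhdsGT (dist_pos.2 (hpinj.ne hjk))] with η hη _
        exact hη.2.le
    obtain ⟨η, h1, h2⟩ := (hev.and self_mem_nhdsWithin).exists
    exact ⟨η, h2, h1⟩
  -- the points `φ_w(p k)` with `w ∈ Z(x, r)` fixed have mutual distances at least `2 θ r`
  set θ := ρ * η / (2 * Q) with hθ
  have hθ0 : 0 < θ := by positivity
  refine ⟨min (θ / 2) (1 / 2), by positivity, by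
    exact (min_le_right _ _).trans_lt (by norm_num), fun x hx => ?_⟩
  obtain ⟨rx, hrx, hrN⟩ := (mem_nhdsGT_iff_exists_Ioo_subset).1 (hN x hx)
  refine ⟨rx, hrx, fun r hr0 hr => ?_⟩
  have hcard : (localStopping (F.pieces E) x r).encard ≤ N := hrN ⟨hr0, hr⟩
  have hfin := finite_of_encard_le_coe hcard
  obtain ⟨f, hf, hfs⟩ := exists_separated_choice (θ := θ * r)
    (fun w k => F.wordMap w (p k)) hfin.toFinset
    (by rw [hfin.encard_eq_coe_toFinset_card] at hcard; exact_mod_cast hcard)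
    (fun w hw j k hjk => by
      have hw' := le_pieceDiam_of_mem_stopping hρ hρd (hfin.mem_toFinset.1 hw).1
      have h1 := h.le_dist w (p j) (p k)
      have h2 : ρ * r * η ≤ F.pieceDiam E w * dist (p j) (p k) :=
        mul_le_mul hw' (hηp j k hjk) hη.le (h.diam_pos w).le
      have e : 2 * (θ * r) = ρ * r * η / Q := by rw [hθ]; field_simp
      rw [e, div_le_iff₀ hQ, mul_comm _ Q]
      exact h2.trans h1)
  refine ⟨f, fun w hw => ?_, fun v hv w hw hne => ?_⟩
  · obtain ⟨k, hk⟩ := hf w (hfin.mem_toFinset.2 hw)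
    rw [Metric.infDist_zero_of_mem (hk ▸ mem_image_of_mem _ (hpE k))]
    exact hr0
  · refine Metric.ball_disjoint_ball ?_
    have := hfs v (hfin.mem_toFinset.2 hv) w (hfin.mem_toFinset.2 hw) hne
    have h1 : min (θ / 2) (1 / 2) * r ≤ θ / 2 * r :=
      mul_le_mul_of_nonneg_right (min_le_left _ _) hr0.le
    linarith

/-- If the points `φ_w(x₀)` are separated, then those with `w ∈ Z(x, r)` form a separated set in a
ball whose radius is a bounded multiple of `r`. -/
theorem finiteClustering_of_separated (h : F.ConformalBounds E Q) (hM : IsDoublingSpace M)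
    {lo : List I → ℝ} (hlo : ∀ w, w ≠ [] → F.pieceDiam E w ≤ Q * lo w) {x₀ : M} {ε : ℝ}
    (hε : 0 < ε) (hsep : ∀ v w : List I, Incomparable v w →
      ε * (lo v + lo w) ≤ dist (F.wordMap v x₀) (F.wordMap w x₀)) :
    Moran.FiniteClustering (F.pieces E) := by
  have := h.nonempty_index
  obtain ⟨ρ, hρ, -, hρd⟩ := h.exists_ratio
  have hQ := h.Q_pos
  obtain ⟨B, hB0, hB⟩ := h.isCompact.isBounded.subset_closedBall_lt 0 x₀
  -- the points `φ_w(x₀)` with `w ∈ Z(x, r)` lie in the ball of radius `K r` about `x`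
  set K := Q * B + 1 with hK
  have hK0 : 0 < K := by positivity
  obtain ⟨N, hN⟩ := hM.exists_encard_le (List I) (θ := ε * (2 * ρ / Q) / K) (by positivity)
  refine finiteClustering_iff.2 ⟨N, fun x _ => ?_⟩
  filter_upwards [self_mem_nhdsWithin] with r hr
  have hr0 : 0 < r := hr
  refine hN x (K * r) (by positivity) _ (fun w => F.wordMap w x₀) (fun w hw => ?_)
    fun v hv w hw hne => ?_
  · obtain ⟨_, ⟨e, he, rfl⟩, hpx⟩ := hw.2
    have h1 := h.dist_le w x₀ e
    have h2 : dist x₀ e ≤ B := by rw [dist_comm]; exact hB he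
    have h3 : Q * F.pieceDiam E w * dist x₀ e ≤ Q * r * B := by
      gcongr
      exact hw.1.2.1
    have h4 := Metric.mem_ball.1 hpx
    rw [Metric.mem_ball]
    have h5 := dist_triangle (F.wordMap w x₀) (F.wordMap w e) x
    rw [hK]
    linarith
  · have hinc : Incomparable v w := incomparable_iff.2
      ⟨h.prefixFree_stopping r hv.1 hw.1 hne, h.prefixFree_stopping r hw.1 hv.1 hne.symm⟩
    refine le_trans ?_ (hsep v w hinc)
    have lower : ∀ u ∈ stopping (F.pieces E) r, ρ * r / Q ≤ lo u := fun u hu => by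
      rw [div_le_iff₀ hQ, mul_comm _ Q]
      exact (le_pieceDiam_of_mem_stopping hρ hρd hu).trans (hlo u hu.1)
    have e : ε * (2 * ρ / Q) / K * (K * r) = ε * (ρ * r / Q + ρ * r / Q) := by
      field_simp
      ring
    rw [e]
    gcongr
    · exact lower v hv.1
    · exact lower w hw.1

end IFS.ConformalBounds

/-! ### Hausdorff measure and Hausdorff content -/

section Content

variable {M : Type*} [MetricSpace M]

/-- The `t`-dimensional Hausdorff content: the infimum of `∑ diam (S n) ^ t` over all countable
covers, without a restriction on the diameters. -/
noncomputable def content (M : Type*) [MetricSpace M] (t : ℝ) : OuterMeasure M :=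
  OuterMeasure.boundedBy fun S => Metric.ediam S ^ t

theorem content_le (t : ℝ) (S : Set M) : content M t S ≤ Metric.ediam S ^ t :=
  OuterMeasure.boundedBy_le S

theorem content_ne_top {t : ℝ} (ht : 0 ≤ t) {S : Set M} (hS : Bornology.IsBounded S) :
    content M t S ≠ ⊤ :=
  ne_top_of_le_ne_top (ENNReal.rpow_ne_top_of_nonneg ht hS.ediam_ne_top) (content_le t S)

variable [MeasurableSpace M] [BorelSpace M]

/-- In a cover with `∑ diam (S n) ^ t` small all diameters are small, so that content zero implies
Hausdorff measure zero. -/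
theorem hausdorffMeasure_eq_zero_of_content {t : ℝ} (ht : 0 < t) {S : Set M}
    (h : content M t S = 0) : μH[t] S = 0 := by
  rw [Measure.hausdorffMeasure_apply]
  refine ENNReal.iSup_eq_zero.2 fun r => ENNReal.iSup_eq_zero.2 fun hr => ?_
  refine le_antisymm (le_of_forall_pos_le_add fun ε hε => ?_) bot_le
  have hpos : 0 < min ε (r ^ t) :=
    lt_min hε (ENNReal.rpow_pos_of_nonneg hr ht.le)
  have h1 : content M t S < min ε (r ^ t) := h ▸ hpos
  rw [content, OuterMeasure.boundedBy_apply] at h1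
  obtain ⟨τ, h1⟩ := iInf_lt_iff.1 h1
  obtain ⟨hτ, h1⟩ := iInf_lt_iff.1 h1
  rw [zero_add]
  refine iInf_le_of_le τ (iInf_le_of_le hτ (iInf_le_of_le (fun n => ?_)
    (h1.le.trans (min_le_left _ _))))
  rcases (τ n).eq_empty_or_nonempty with hn | hn
  · simp [hn]
  · rw [← ENNReal.rpow_le_rpow_iff ht]
    calc Metric.ediam (τ n) ^ t = ⨆ _ : (τ n).Nonempty, Metric.ediam (τ n) ^ t := by simp [hn]
      _ ≤ ∑' n, ⨆ _ : (τ n).Nonempty, Metric.ediam (τ n) ^ t := ENNReal.le_tsum n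
      _ ≤ r ^ t := h1.le.trans (min_le_right _ _)

/-- A set of measure zero is covered by small balls that are centred at points of the set and have
arbitrarily small total `t`-th power of the radii. -/
theorem exists_ball_cover {t : ℝ} (ht : 0 < t) {S : Set M} (h : μH[t] S = 0) {ε : ENNReal}
    (hε : ε ≠ 0) {r₀ : ℝ} (hr₀ : 0 < r₀) :
    ∃ (ι : Type) (x : ι → M) (r : ι → ℝ), (∀ k, x k ∈ S ∧ 0 < r k ∧ r k < r₀) ∧
      S ⊆ ⋃ k, Metric.ball (x k) (r k) ∧ ∑' k, ENNReal.ofReal (r k ^ t) ≤ ε := by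
  set ε₁ := min ε (ENNReal.ofReal (r₀ ^ t)) / 2 with hε₁
  have hr₀t : 0 < r₀ ^ t := Real.rpow_pos_of_pos hr₀ t
  have hmin : min ε (ENNReal.ofReal (r₀ ^ t)) ≠ 0 :=
    (lt_min (pos_iff_ne_zero.2 hε) (ENNReal.ofReal_pos.2 hr₀t)).ne'
  have hε₁0 : ε₁ ≠ 0 := (ENNReal.half_pos hmin).ne'
  obtain ⟨e, he, hesum⟩ := ENNReal.exists_pos_sum_of_countable hε₁0 ℕ
  rw [Measure.hausdorffMeasure_apply] at h
  have h1 := ENNReal.iSup_eq_zero.1 (ENNReal.iSup_eq_zero.1 h 1) one_pos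
  have h2 := h1.trans_lt (pos_iff_ne_zero.2 hε₁0)
  obtain ⟨τ, h2⟩ := iInf_lt_iff.1 h2
  obtain ⟨hτ, h2⟩ := iInf_lt_iff.1 h2
  obtain ⟨hτ1, h2⟩ := iInf_lt_iff.1 h2
  have hfin : ∀ n, Metric.ediam (τ n) ≠ ⊤ := fun n => ne_top_of_le_ne_top ENNReal.one_ne_top (hτ1 n)
  let J := {n : ℕ // (τ n ∩ S).Nonempty}
  -- this radius is larger than the diameter, and its `t`-th power exceeds that of the diameter
  -- by `e n`
  let r : ℕ → ℝ := fun n => (Metric.diam (τ n) ^ t + e n) ^ t⁻¹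
  have hrpos : ∀ n, 0 < Metric.diam (τ n) ^ t + e n := fun n =>
    add_pos_of_nonneg_of_pos (Real.rpow_nonneg Metric.diam_nonneg t) (NNReal.coe_pos.2 (he n))
  have hrt : ∀ n, r n ^ t = Metric.diam (τ n) ^ t + e n := fun n =>
    Real.rpow_inv_rpow (hrpos n).le ht.ne'
  have hr0 : ∀ n, 0 < r n := fun n => Real.rpow_pos_of_pos (hrpos n) _
  have hle : ∀ n : J, ENNReal.ofReal (r n ^ t) ≤
      (⨆ _ : (τ n).Nonempty, Metric.ediam (τ n) ^ t) + e n := by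
    rintro ⟨n, hn⟩
    have hne : (τ n).Nonempty := hn.mono inter_subset_left
    change ENNReal.ofReal (r n ^ t) ≤ (⨆ _ : (τ n).Nonempty, Metric.ediam (τ n) ^ t) + e n
    rw [hrt, ENNReal.ofReal_add (Real.rpow_nonneg Metric.diam_nonneg t) (e n).coe_nonneg,
      ENNReal.ofReal_coe_nnreal, ← ENNReal.ofReal_rpow_of_nonneg Metric.diam_nonneg ht.le,
      Metric.diam, ENNReal.ofReal_toReal (hfin n)]
    simp [hne]
  have hsum : ∑' n : J, ENNReal.ofReal (r n ^ t) < min ε (ENNReal.ofReal (r₀ ^ t)) := by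
    calc ∑' n : J, ENNReal.ofReal (r n ^ t)
        ≤ ∑' n : J, ((⨆ _ : (τ n).Nonempty, Metric.ediam (τ n) ^ t) + e n) :=
          ENNReal.tsum_le_tsum hle
      _ ≤ ∑' n : ℕ, ((⨆ _ : (τ n).Nonempty, Metric.ediam (τ n) ^ t) + e n) :=
          ENNReal.tsum_comp_le_tsum_of_injective Subtype.val_injective _
      _ = ∑' n : ℕ, (⨆ _ : (τ n).Nonempty, Metric.ediam (τ n) ^ t) + ∑' n, (e n : ENNReal) :=
          ENNReal.tsum_add
      _ < ε₁ + ε₁ := ENNReal.add_lt_add h2 hesum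
      _ = _ := ENNReal.add_halves _
  refine ⟨J, fun n => n.2.some, fun n => r n, fun n => ⟨n.2.some_mem.2, hr0 n, ?_⟩, fun z hz => ?_,
    hsum.le.trans (min_le_left _ _)⟩
  · have := ((ENNReal.le_tsum n).trans_lt hsum).trans_le (min_le_right _ _)
    rw [ENNReal.ofReal_lt_ofReal_iff hr₀t] at this
    exact (Real.rpow_lt_rpow_iff (hr0 n).le hr₀.le ht).1 this
  · obtain ⟨n, hn⟩ := mem_iUnion.1 (hτ hz)
    let k : J := ⟨n, z, hn, hz⟩
    refine mem_iUnion.2 ⟨k, Metric.mem_ball.2 ?_⟩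
    have hd : dist z k.2.some ≤ Metric.diam (τ n) :=
      Metric.dist_le_diam_of_mem' (hfin n) hn k.2.some_mem.1
    refine hd.trans_lt ((Real.rpow_lt_rpow_iff Metric.diam_nonneg (hr0 n).le ht).1 ?_)
    rw [hrt]
    exact lt_add_of_pos_right _ (NNReal.coe_pos.2 (he n))

end Content

namespace IFS.ConformalBounds

variable {I M : Type*} [Fintype I] [MetricSpace M] {F : IFS I M} {E : Set M} {Q : ℝ}

/-! ### Finite clustering implies positive Hausdorff measure -/

section MeasurePos

variable [MeasurableSpace M] [BorelSpace M]

/-- Let `N` bound the clustering numbers, and let `S n` consist of the points `x` for which the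
bound holds at all scales below `1 / (n + 1)`. If `E` had measure zero, then it would be covered by
balls, centred in `S n` and of radius below `1 / (n + 1)` for some `n`, with small sum of the `t`-th
powers of the radii. By compactness finitely many of them suffice, and the words in the
corresponding sets `Z(x, r)` give a cover of all infinite words whose total mass is too small. -/
theorem hausdorffMeasure_pos (h : F.ConformalBounds E Q) {t : ℝ} (ht : 0 < t)
    {m : List I → ℝ} (hm : ∀ w, m w = ∑ i, m (w ++ [i])) (hm0 : ∀ w, 0 < m w) {C : ℝ}
    (hmC : ∀ w, m w ≤ C * F.pieceDiam E w ^ t)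
    (hfc : Moran.FiniteClustering (F.pieces E)) : 0 < μH[t] E := by
  classical
  rw [pos_iff_ne_zero]
  intro hnull
  obtain ⟨N, hN⟩ := finiteClustering_iff.1 hfc
  rw [h.limitSet_eq] at hN
  have hC : 0 < C :=
    pos_of_mul_pos_left ((hm0 []).trans_le (hmC [])) (Real.rpow_pos_of_pos (h.diam_pos []) t).le
  let S : ℕ → Set M := fun n => {x | x ∈ E ∧ ∀ r : ℝ, 0 < r → r < 1 / ((n : ℝ) + 1) →
    (localStopping (F.pieces E) x r).encard ≤ N}
  have hS : E ⊆ ⋃ n, S n := by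
    intro x hx
    obtain ⟨rx, hrx, hr⟩ := (mem_nhdsGT_iff_exists_Ioo_subset).1 (hN x hx)
    obtain ⟨n, hn⟩ := exists_nat_one_div_lt (show (0 : ℝ) < rx from hrx)
    exact mem_iUnion.2 ⟨n, hx, fun r h0 h1 => hr ⟨h0, h1.trans hn⟩⟩
  set ε := m [] / (2 * ((N + 1) * C)) with hε
  have hε0 : 0 < ε := div_pos (hm0 []) (by positivity)
  obtain ⟨e, he, hesum⟩ := ENNReal.exists_pos_sum_of_countable
    (ENNReal.ofReal_pos.2 hε0).ne' ℕ
  have hcover := fun n : ℕ => exists_ball_cover ht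
    (measure_mono_null (fun x hx => hx.1 : S n ⊆ E) hnull)
    (ENNReal.coe_ne_zero.2 (he n).ne')
    (lt_min (by positivity : 0 < 1 / ((n : ℝ) + 1)) (h.diam_pos []))
  choose ι x r hxr hcov hsum using hcover
  obtain ⟨T, hT⟩ := h.isCompact.elim_finite_subcover
    (fun p : Σ n, ι n => Metric.ball (x p.1 p.2) (r p.1 p.2)) (fun _ => Metric.isOpen_ball)
    (fun z hz => by
      obtain ⟨n, hn⟩ := mem_iUnion.1 (hS hz)
      obtain ⟨k, hk⟩ := mem_iUnion.1 (hcov n hn)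
      exact mem_iUnion.2 ⟨⟨n, k⟩, hk⟩)
  have hZ : ∀ p : Σ n, ι n,
      (localStopping (F.pieces E) (x p.1 p.2) (r p.1 p.2)).encard ≤ N := fun p => by
    obtain ⟨h1, h2, h3⟩ := hxr p.1 p.2
    exact h1.2 _ h2 (h3.trans_le (min_le_left _ _))
  have hZfin := fun p => finite_of_encard_le_coe (hZ p)
  -- the words from the sets `Z(x, r)` that belong to the finite subcover
  let W : Finset (List I) := T.biUnion fun p => (hZfin p).toFinset
  have hrpos : ∀ p : Σ n, ι n, 0 < r p.1 p.2 := fun p => (hxr p.1 p.2).2.1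
  -- a level so high that all pieces are smaller than each of the finitely many radii
  choose L hL using fun p : Σ n, ι n => h.exists_level (hrpos p)
  have hWcov : ∀ v : List I, v.length = T.sup L → ∃ w ∈ W, w <+: v := by
    intro v hv
    obtain ⟨z, hz⟩ := h.pieces_nonempty v
    obtain ⟨p, hp, hzp⟩ := mem_iUnion₂.1 (hT (h.pieces_subset_self v hz))
    obtain ⟨w, hwv, hw⟩ := exists_prefix_stopping
      ((hxr p.1 p.2).2.2.trans_le (min_le_right _ _))
      (hL p v (hv ▸ Finset.le_sup hp)).le
    exact ⟨w, Finset.mem_biUnion.2 ⟨p, hp, (hZfin p).mem_toFinset.2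
      ⟨hw, z, h.pieces_subset hwv hz, hzp⟩⟩, hwv⟩
  have h1 := le_sum_of_covers hm (fun w => (hm0 w).le) _ W hWcov []
  have hZsum : ∀ p ∈ T, ∑ w ∈ (hZfin p).toFinset, m w ≤ (N * C) * r p.1 p.2 ^ t := by
    intro p _
    have hcard : (hZfin p).toFinset.card ≤ N := by
      have := hZ p
      rw [(hZfin p).encard_eq_coe_toFinset_card] at this
      exact_mod_cast this
    have hb : 0 ≤ C * r p.1 p.2 ^ t := mul_nonneg hC.le (Real.rpow_pos_of_pos (hrpos p) t).le
    calc ∑ w ∈ (hZfin p).toFinset, m w ≤ (hZfin p).toFinset.card • (C * r p.1 p.2 ^ t) := by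
          refine Finset.sum_le_card_nsmul _ _ _ fun w hw => (hmC w).trans ?_
          gcongr
          · exact (h.diam_pos w).le
          · exact ((hZfin p).mem_toFinset.1 hw).1.2.1
      _ ≤ N * (C * r p.1 p.2 ^ t) := by
          rw [nsmul_eq_mul]
          gcongr
      _ = _ := by ring
  have hTsum : ∑ p ∈ T, r p.1 p.2 ^ t ≤ ε := by
    rw [← ENNReal.ofReal_le_ofReal_iff hε0.le,
      ENNReal.ofReal_sum_of_nonneg fun p _ => (Real.rpow_pos_of_pos (hrpos p) t).le]
    calc ∑ p ∈ T, ENNReal.ofReal (r p.1 p.2 ^ t)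
        ≤ ∑' p : Σ n, ι n, ENNReal.ofReal (r p.1 p.2 ^ t) := ENNReal.sum_le_tsum T
      _ = ∑' n, ∑' k, ENNReal.ofReal (r n k ^ t) :=
          ENNReal.tsum_sigma fun n k => ENNReal.ofReal (r n k ^ t)
      _ ≤ ∑' n, (e n : ENNReal) := ENNReal.tsum_le_tsum hsum
      _ ≤ _ := hesum.le
  have : m [] ≤ (N * C) * ε := by
    calc m [] ≤ ∑ w ∈ W, m w := by simpa using h1
      _ ≤ ∑ p ∈ T, ∑ w ∈ (hZfin p).toFinset, m w :=
          sum_biUnion_le _ _ fun w => (hm0 w).le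
      _ ≤ ∑ p ∈ T, (N * C) * r p.1 p.2 ^ t := Finset.sum_le_sum hZsum
      _ = (N * C) * ∑ p ∈ T, r p.1 p.2 ^ t := by rw [Finset.mul_sum]
      _ ≤ _ := by gcongr
  have h2 : (N * C) * ε < ((N + 1) * C) * (2 * ε) := by nlinarith [mul_pos hC hε0]
  have h3 : ((N + 1) * C) * (2 * ε) = m [] := by
    rw [hε]
    field_simp
  linarith

end MeasurePos

/-! ### Positive Hausdorff measure implies regularity -/

/-- If a set function is dominated by `g m` on all pieces, then passing to the
complement of a set `B` gains at least the mass of an antichain of pieces inside `B`. -/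
theorem add_sum_le (h : F.ConformalBounds E Q) {φ : Set M → ℝ} (hφ0 : φ ∅ = 0)
    (hφm : Monotone φ) (hφ : ∀ S : I → Set M, φ (⋃ i, S i) ≤ ∑ i, φ (S i))
    {m : List I → ℝ} (hm : ∀ w, m w = ∑ i, m (w ++ [i])) {g : ℝ}
    (hg : ∀ w, φ (F.pieces E w) ≤ g * m w) (B : Set M) (n : ℕ) (W : Finset (List I))
    (hWn : ∀ w ∈ W, w.length ≤ n) (hW : PrefixFree (W : Set (List I))) (p : List I)
    (hWB : ∀ w ∈ W, F.pieces E (p ++ w) ⊆ B) :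
    φ (F.pieces E p \ B) + g * ∑ w ∈ W, m (p ++ w) ≤ g * m p := by
  induction n generalizing W p with
  | zero =>
    by_cases h0 : [] ∈ W
    · have hp : F.pieces E p \ B = ∅ := sdiff_eq_empty.2 (by simpa using hWB [] h0)
      rw [hp, hφ0, hW.eq_singleton_nil h0]
      simp
    · have : W = ∅ := Finset.eq_empty_of_forall_notMem fun w hw => by
        have := hWn w hw
        rw [Nat.le_zero, List.length_eq_zero_iff] at this
        exact h0 (this ▸ hw)
      rw [this, Finset.sum_empty, mul_zero, add_zero]
      exact (hφm sdiff_subset).trans (hg p)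
  | succ n ih =>
    by_cases h0 : [] ∈ W
    · have hp : F.pieces E p \ B = ∅ := sdiff_eq_empty.2 (by simpa using hWB [] h0)
      rw [hp, hφ0, hW.eq_singleton_nil h0]
      simp
    · rw [sum_eq_sum_tails h0, hm p, h.pieces_eq_iUnion p, iUnion_sdiff, Finset.mul_sum,
        Finset.mul_sum]
      refine (add_le_add_left (hφ _) _).trans ?_
      rw [← Finset.sum_add_distrib]
      refine Finset.sum_le_sum fun i _ => ?_
      have := ih (tails W i) (fun w hw => by simpa using hWn _ (mem_tails.1 hw)) (hW.tails i)
        (p ++ [i]) (fun w hw => by simpa using hWB _ (mem_tails.1 hw))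
      simpa using this

variable [MeasurableSpace M] [BorelSpace M]

/-- If `E` has positive Hausdorff measure, then the mass of the pieces inside a set `A` is at most
a multiple of `diam A ^ t`. Let `g` be the supremum of the quotients of the content of
`φ_v(E)` and `m v`. Replacing the pieces `φ_{vw}(E)`, `w ∈ W`, in a cover of `φ_v(E)` by the single
set `φ_v(A)` shows that `g` is at most `g (1 - c ∑ m w) + C diam A ^ t`, and `g` cancels. -/
theorem exists_sum_le_mul_diam (h : F.ConformalBounds E Q) {t : ℝ} (ht : 0 < t)
    {m : List I → ℝ} (hm : ∀ w, m w = ∑ i, m (w ++ [i])) {C : ℝ}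
    (hCm : ∀ w, F.pieceDiam E w ^ t ≤ C * m w) (hm0 : ∀ w, 0 < m w)
    (hmC : ∀ w, m w ≤ C * F.pieceDiam E w ^ t) (hpos : 0 < μH[t] E) :
    ∃ K : ℝ, 0 < K ∧ ∀ (W : Finset (List I)) (A : Set M), PrefixFree (W : Set (List I)) →
      Bornology.IsBounded A → (∀ w ∈ W, F.pieces E w ⊆ A) →
      ∑ w ∈ W, m w ≤ K * Metric.diam A ^ t := by
  have hC : 0 < C :=
    pos_of_mul_pos_left ((hm0 []).trans_le (hmC [])) (Real.rpow_pos_of_pos (h.diam_pos []) t).le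
  have hQt : 0 < Q ^ t := Real.rpow_pos_of_pos h.Q_pos t
  have hEfin : ∀ S : Set M, content M t (S ∩ E) ≠ ⊤ := fun S =>
    content_ne_top ht.le (h.isCompact.isBounded.subset inter_subset_right)
  -- the intersection with the compact set `E` keeps the content finite, so that it can be taken
  -- in `ℝ`
  let φ : Set M → ℝ := fun S => (content M t (S ∩ E)).toReal
  have hφ0 : φ ∅ = 0 := by simp [φ]
  have hφm : Monotone φ := fun S T hST =>
    ENNReal.toReal_mono (hEfin T) (measure_mono (inter_subset_inter_left E hST))
  have hφU : ∀ S : I → Set M, φ (⋃ i, S i) ≤ ∑ i, φ (S i) := fun S => by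
    simp only [φ]
    rw [← ENNReal.toReal_sum fun i _ => hEfin (S i)]
    refine ENNReal.toReal_mono (ENNReal.sum_ne_top.2 fun i _ => hEfin (S i)) ?_
    rw [iUnion_inter]
    exact measure_iUnion_fintype_le _ _
  have hφ2 : ∀ S T : Set M, φ S ≤ φ T + φ (S \ T) := fun S T => by
    simp only [φ]
    rw [← ENNReal.toReal_add (hEfin _) (hEfin _)]
    refine ENNReal.toReal_mono (ENNReal.add_ne_top.2 ⟨hEfin _, hEfin _⟩) ?_
    refine (measure_mono ?_).trans (measure_union_le _ _)
    rw [← union_inter_distrib_right]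
    refine inter_subset_inter_left E ?_
    rw [union_sdiff_self]
    exact subset_union_right
  have hφd : ∀ S : Set M, Bornology.IsBounded S → φ S ≤ Metric.diam S ^ t := fun S hS => by
    rw [Metric.diam, ENNReal.toReal_rpow]
    exact ENNReal.toReal_mono (ENNReal.rpow_ne_top_of_nonneg ht.le hS.ediam_ne_top)
      ((measure_mono inter_subset_left).trans (content_le t S))
  have hbdd : BddAbove (range fun v => φ (F.pieces E v) / m v) := by
    refine ⟨C, ?_⟩
    rintro _ ⟨v, rfl⟩
    simp only
    rw [div_le_iff₀ (hm0 v)]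
    exact (hφd _ (h.isCompact_pieces v).isBounded).trans (hCm v)
  set g := ⨆ v, φ (F.pieces E v) / m v with hgdef
  have hg : ∀ v, φ (F.pieces E v) ≤ g * m v := fun v => by
    rw [← div_le_iff₀ (hm0 v)]
    exact le_ciSup hbdd v
  have hg0 : 0 < g := by
    have : 0 < φ (F.pieces E []) := by
      refine ENNReal.toReal_pos ?_ (hEfin _)
      rw [pieces_nil, inter_self]
      exact fun h0 => hpos.ne' (hausdorffMeasure_eq_zero_of_content ht h0)
    exact pos_of_mul_pos_left (this.trans_le (hg [])) (hm0 []).le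
  set c := (C ^ 3 * Q ^ t)⁻¹ with hc
  have hc0 : 0 < c := by positivity
  have hmul : ∀ v w, c * (m v * m w) ≤ m (v ++ w) := fun v w => by
    rw [hc, inv_mul_le_iff₀ (by positivity)]
    have hfv := Real.rpow_pos_of_pos (h.diam_pos v) t
    calc m v * m w ≤ (C * F.pieceDiam E v ^ t) * (C * F.pieceDiam E w ^ t) :=
          mul_le_mul (hmC v) (hmC w) (hm0 w).le (by positivity)
      _ = C ^ 2 * (F.pieceDiam E v ^ t * F.pieceDiam E w ^ t) := by ring
      _ ≤ C ^ 2 * (Q ^ t * F.pieceDiam E (v ++ w) ^ t) := by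
          exact mul_le_mul_of_nonneg_left ((h.quasiMult.rpow ht.le).le_append v w) (by positivity)
      _ ≤ C ^ 2 * (Q ^ t * (C * m (v ++ w))) := by
          gcongr
          exact hCm _
      _ = _ := by ring
  refine ⟨Q ^ t * C / (g * c), by positivity, fun W A hW hA hWA => ?_⟩
  have hdA : 0 ≤ Metric.diam A ^ t := Real.rpow_nonneg Metric.diam_nonneg t
  have key : ∀ v, φ (F.pieces E v) / m v ≤
      Q ^ t * C * Metric.diam A ^ t + g - g * c * ∑ w ∈ W, m w := by
    intro v
    have h1 := h.add_sum_le hφ0 hφm hφU hm hg (F.wordMap v '' A) (W.sup List.length) W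
      (fun w hw => Finset.le_sup hw) hW v
      (fun w hw => by rw [pieces_append]; exact image_mono (hWA w hw))
    have h2 := hφ2 (F.pieces E v) (F.wordMap v '' A)
    have hdv : 0 ≤ Q * F.pieceDiam E v := (mul_pos h.Q_pos (h.diam_pos v)).le
    have hbd : Bornology.IsBounded (F.wordMap v '' A) :=
      (LipschitzWith.of_dist_le_mul (K := Real.toNNReal (Q * F.pieceDiam E v)) fun x y => by
        rw [Real.coe_toNNReal _ hdv]; exact h.dist_le v x y).isBounded_image hA
    have h3 : φ (F.wordMap v '' A) ≤ Q ^ t * (C * m v) * Metric.diam A ^ t := by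
      calc φ (F.wordMap v '' A) ≤ Metric.diam (F.wordMap v '' A) ^ t := hφd _ hbd
        _ ≤ (Q * F.pieceDiam E v * Metric.diam A) ^ t :=
            Real.rpow_le_rpow Metric.diam_nonneg
              (Metric.diam_image_le_mul hdv hA (h.dist_le v)) ht.le
        _ = Q ^ t * F.pieceDiam E v ^ t * Metric.diam A ^ t := by
            rw [Real.mul_rpow hdv Metric.diam_nonneg,
              Real.mul_rpow h.Q_pos.le (h.diam_pos v).le]
        _ ≤ _ := by
            gcongr
            exact hCm v
    have h4 : g * (c * m v * ∑ w ∈ W, m w) ≤ g * ∑ w ∈ W, m (v ++ w) := by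
      gcongr
      rw [Finset.mul_sum]
      exact Finset.sum_le_sum fun w _ => by rw [mul_assoc]; exact hmul v w
    rw [div_le_iff₀ (hm0 v)]
    have e : (Q ^ t * C * Metric.diam A ^ t + g - g * c * ∑ w ∈ W, m w) * m v =
        Q ^ t * (C * m v) * Metric.diam A ^ t + g * m v - g * (c * m v * ∑ w ∈ W, m w) := by ring
    rw [e]
    linarith
  have hfinal := ciSup_le key
  rw [← hgdef] at hfinal
  rw [div_mul_eq_mul_div, le_div_iff₀ (by positivity)]
  linarith

end IFS.ConformalBounds

/-! ### Clusters of incomparable pieces -/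

section Words

variable {I : Type*}

/-- Two incomparable words part at some letter: the second one has an initial segment that is
incomparable with the first one and that exceeds a common initial segment by one letter. -/
theorem exists_branching {v w : List I} (hvw : ¬ v <+: w) (hwv : ¬ w <+: v) :
    ∃ z i, z <+: v ∧ z ++ [i] <+: w ∧ ¬ z ++ [i] <+: v ∧ ¬ v <+: z ++ [i] := by
  suffices ∃ z i, z <+: v ∧ z ++ [i] <+: w ∧ ¬ z ++ [i] <+: v by
    obtain ⟨z, i, h1, h2, h3⟩ := this
    exact ⟨z, i, h1, h2, h3, fun h4 => hvw (h4.trans h2)⟩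
  clear hvw
  induction w using List.reverseRecOn with
  | nil => exact absurd List.nil_prefix hwv
  | append_singleton w i ih =>
    by_cases h : w <+: v
    · exact ⟨w, i, h, List.prefix_rfl, hwv⟩
    · obtain ⟨z, j, h1, h2, h3⟩ := ih h
      exact ⟨z, j, h1, h2.trans (List.prefix_append _ _), h3⟩

end Words

namespace IFS

variable {I M : Type*} [MetricSpace M]

/-- There are `k` pairwise incomparable words whose pieces meet a common closed ball that is
centred at a point of `E` and is small compared to each of them: its radius is at most `b` times
the diameter of each piece, and of `E`. -/
def HasCluster (F : IFS I M) (E : Set M) (b : ℝ) (k : ℕ) : Prop :=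
  ∃ W : Finset (List I), PrefixFree (W : Set (List I)) ∧ W.card = k ∧ ∃ y ∈ E, ∃ η : ℝ, 0 < η ∧
    η ≤ b * F.pieceDiam E [] ∧ ∀ w ∈ W, η ≤ b * F.pieceDiam E w ∧
      (F.pieces E w ∩ Metric.closedBall y η).Nonempty

namespace ConformalBounds

variable {F : IFS I M} {E : Set M} {Q : ℝ} [Fintype I]

/-- The pieces of a cluster contain pieces of diameter comparable to the radius `η`, and these lie
in a set of diameter at most `4 η`. -/
theorem exists_cluster_bound (h : F.ConformalBounds E Q) [MeasurableSpace M] [BorelSpace M]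
    {t : ℝ} (ht : 0 < t)
    {m : List I → ℝ} (hm : ∀ w, m w = ∑ i, m (w ++ [i])) {C : ℝ}
    (hCm : ∀ w, F.pieceDiam E w ^ t ≤ C * m w) (hm0 : ∀ w, 0 < m w)
    (hmC : ∀ w, m w ≤ C * F.pieceDiam E w ^ t) (hpos : 0 < μH[t] E) :
    ∃ N : ℕ, ∀ k, F.HasCluster E 1 k → k ≤ N := by
  classical
  obtain ⟨K, hK0, hK⟩ := h.exists_sum_le_mul_diam ht hm hCm hm0 hmC hpos
  obtain ⟨ρ, hρ, hρ1, hρd⟩ := h.exists_ratio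
  have hC : 0 < C :=
    pos_of_mul_pos_left ((hm0 []).trans_le (hmC [])) (Real.rpow_pos_of_pos (h.diam_pos []) t).le
  refine ⟨⌊C * (K * 4 ^ t) / ρ ^ t⌋₊, ?_⟩
  rintro k ⟨W, hW, rfl, y, hy, η, hη, -, hη1⟩
  have hext : ∀ w, ∃ v, w ∈ W → w <+: v ∧ (F.pieces E v ∩ Metric.closedBall y η).Nonempty ∧
      F.pieceDiam E v ≤ η ∧ ρ * η ≤ F.pieceDiam E v := by
    intro w
    by_cases hw : w ∈ W
    · obtain ⟨h1, x, hx, hxy⟩ := hη1 w hw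
      rw [one_mul] at h1
      obtain ⟨v, hv, hxv, hv'⟩ := h.exists_extension hρ hρ1 hρd hη hx h1
      exact ⟨v, fun _ => ⟨hv, ⟨x, hxv, hxy⟩, hv'⟩⟩
    · exact ⟨w, fun h => absurd h hw⟩
  -- the extended words `e w` inherit incomparability
  choose e he using hext
  have hpre : ∀ v ∈ W, ∀ w ∈ W, e v <+: e w → v = w := by
    intro v hv w hw hvw
    rcases List.prefix_or_prefix_of_prefix ((he v hv).1.trans hvw) (he w hw).1 with h1 | h1
    · exact hW.eq hv hw h1
    · exact (hW.eq hw hv h1).symm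
  have hinj : InjOn e (W : Set (List I)) := fun v hv w hw hvw =>
    hpre v hv w hw (hvw ▸ List.prefix_rfl)
  have hfree : PrefixFree ((W.image e : Finset (List I)) : Set (List I)) := by
    intro v' hv' w' hw' hne hvw
    obtain ⟨v, hv, rfl⟩ := Finset.mem_image.1 hv'
    obtain ⟨w, hw, rfl⟩ := Finset.mem_image.1 hw'
    exact hne (congrArg e (hpre v hv w hw hvw))
  have hsub : ∀ v ∈ W.image e, F.pieces E v ⊆ Metric.closedBall y (2 * η) := by
    intro v' hv' z hz
    obtain ⟨v, hv, rfl⟩ := Finset.mem_image.1 hv'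
    obtain ⟨-, ⟨p, hp, hpy⟩, hd, -⟩ := he v hv
    have h1 := h.dist_le_pieceDiam hz hp
    have h2 := Metric.mem_closedBall.1 hpy
    rw [Metric.mem_closedBall]
    linarith [dist_triangle z p y]
  have hmain := hK (W.image e) (Metric.closedBall y (2 * η)) hfree Metric.isBounded_closedBall hsub
  rw [Finset.sum_image hinj] at hmain
  have hηt : 0 < η ^ t := Real.rpow_pos_of_pos hη t
  have hρt : 0 < ρ ^ t := Real.rpow_pos_of_pos hρ t
  have hdiam : Metric.diam (Metric.closedBall y (2 * η)) ^ t ≤ 4 ^ t * η ^ t := by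
    rw [← Real.mul_rpow (by norm_num) hη.le]
    refine Real.rpow_le_rpow Metric.diam_nonneg ?_ ht.le
    exact (Metric.diam_closedBall (by positivity)).trans_eq (by ring)
  have hlow : W.card • (ρ ^ t * η ^ t / C) ≤ ∑ w ∈ W, m (e w) := by
    refine Finset.card_nsmul_le_sum _ _ _ fun w hw => ?_
    rw [div_le_iff₀ hC, mul_comm _ C, ← Real.mul_rpow hρ.le hη.le]
    exact (Real.rpow_le_rpow (by positivity) (he w hw).2.2.2 ht.le).trans (hCm _)
  rw [nsmul_eq_mul] at hlow
  refine Nat.le_floor ?_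
  rw [le_div_iff₀ hρt]
  have h1 : W.card * (ρ ^ t * η ^ t / C) ≤ K * (4 ^ t * η ^ t) :=
    hlow.trans (hmain.trans (mul_le_mul_of_nonneg_left hdiam hK0.le))
  have h2 : W.card * (ρ ^ t * η ^ t / C) = W.card * ρ ^ t / C * η ^ t := by ring
  rw [h2, ← mul_assoc] at h1
  have h3 := le_of_mul_le_mul_right h1 hηt
  rw [div_le_iff₀ hC] at h3
  linarith

omit [Fintype I] in
/-- Suppose the point `y` is the centre of a cluster of `k` pieces, and that `φ_v(y)` and `φ_w(y)`
are close for some incomparable `v` and `w`. The images under `φ_v` of the pieces of the cluster,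
together with the piece of an initial segment of `w` that is incomparable with `v`, form a cluster
of `k + 1` pieces near `φ_v(y)`. -/
theorem hasCluster_succ (h : F.ConformalBounds E Q) {ρ : ℝ} (hρ : 0 < ρ) (hρ1 : ρ ≤ 1)
    (hρd : ∀ w i, ρ * F.pieceDiam E w ≤ F.pieceDiam E (w ++ [i])) {b b' : ℝ} (hb : 0 < b)
    (hbQ : 2 * Q ^ 2 * b ≤ b') (hbρ : 2 * Q * b * F.pieceDiam E [] ≤ b' * ρ)
    {W : Finset (List I)} (hW : PrefixFree (W : Set (List I))) {y : M} (hy : y ∈ E) {η : ℝ}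
    (hη : 0 < η) (hη0 : η ≤ b * F.pieceDiam E [])
    (hηW : ∀ w ∈ W, η ≤ b * F.pieceDiam E w ∧ (F.pieces E w ∩ Metric.closedBall y η).Nonempty)
    {v w : List I} (hvw : ¬ v <+: w) (hwv : ¬ w <+: v)
    (hd : F.pieceDiam E w ≤ F.pieceDiam E v)
    (hclose : dist (F.wordMap v y) (F.wordMap w y) ≤
      Q * η * (F.pieceDiam E v + F.pieceDiam E w)) :
    F.HasCluster E b' (W.card + 1) := by
  classical
  have hQ := h.Q_pos
  have hb' : 0 < b' := lt_of_lt_of_le (by positivity) hbQ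
  obtain ⟨z, i, hzv, hzw, hzi, hvz⟩ := exists_branching hvw hwv
  have hdv := h.diam_pos v
  have hd0 := h.diam_pos []
  have hzd : ρ * F.pieceDiam E v ≤ F.pieceDiam E (z ++ [i]) :=
    (mul_le_mul_of_nonneg_left (h.pieceDiam_anti hzv) hρ.le).trans (hρd z i)
  have hnot : z ++ [i] ∉ W.image (v ++ ·) := by
    intro hmem
    obtain ⟨u, -, hu⟩ := Finset.mem_image.1 hmem
    exact hvz (hu ▸ List.prefix_append v u)
  refine ⟨insert (z ++ [i]) (W.image (v ++ ·)), ?_, ?_, F.wordMap v y,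
    h.pieces_subset_self v (mem_image_of_mem _ hy), 2 * Q * η * F.pieceDiam E v, by positivity,
    ?_, fun u hu => ?_⟩
  · intro u hu u' hu' hne hpre
    rcases Finset.mem_insert.1 hu with rfl | hu <;> rcases Finset.mem_insert.1 hu' with rfl | hu'
    · exact hne rfl
    · obtain ⟨a, -, rfl⟩ := Finset.mem_image.1 hu'
      rcases List.prefix_or_prefix_of_prefix hpre (List.prefix_append v a) with h1 | h1
      · exact hzi h1
      · exact hvz h1
    · obtain ⟨a, -, rfl⟩ := Finset.mem_image.1 hu
      exact hvz ((List.prefix_append v a).trans hpre)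
    · obtain ⟨a, ha, rfl⟩ := Finset.mem_image.1 hu
      obtain ⟨a', ha', rfl⟩ := Finset.mem_image.1 hu'
      exact hne (congrArg (v ++ ·) (hW.eq ha ha' ((List.prefix_append_right_inj v).1 hpre)))
  · rw [Finset.card_insert_of_notMem hnot,
      Finset.card_image_of_injective _ (List.append_right_injective v)]
  · have h1 : F.pieceDiam E v ≤ F.pieceDiam E [] := h.pieceDiam_anti List.nil_prefix
    calc 2 * Q * η * F.pieceDiam E v ≤ 2 * Q * (b * F.pieceDiam E []) * F.pieceDiam E [] := by
          gcongr
      _ = 2 * Q * b * F.pieceDiam E [] * F.pieceDiam E [] := by ring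
      _ ≤ b' * F.pieceDiam E [] := by
          gcongr
          exact hbρ.trans (mul_le_of_le_one_right hb'.le hρ1)
  · rcases Finset.mem_insert.1 hu with rfl | hu
    · constructor
      · calc 2 * Q * η * F.pieceDiam E v ≤ 2 * Q * (b * F.pieceDiam E []) * F.pieceDiam E v := by
              gcongr
          _ = 2 * Q * b * F.pieceDiam E [] * F.pieceDiam E v := by ring
          _ ≤ b' * ρ * F.pieceDiam E v := by gcongr
          _ = b' * (ρ * F.pieceDiam E v) := by ring
          _ ≤ _ := by gcongr
      · refine ⟨F.wordMap w y, h.pieces_subset hzw (mem_image_of_mem _ hy), ?_⟩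
        rw [Metric.mem_closedBall, dist_comm]
        refine hclose.trans ?_
        calc Q * η * (F.pieceDiam E v + F.pieceDiam E w)
            ≤ Q * η * (F.pieceDiam E v + F.pieceDiam E v) := by gcongr
          _ = _ := by ring
    · obtain ⟨a, ha, rfl⟩ := Finset.mem_image.1 hu
      obtain ⟨h1, p, hp, hpy⟩ := hηW a ha
      constructor
      · calc 2 * Q * η * F.pieceDiam E v ≤ 2 * Q * (b * F.pieceDiam E a) * F.pieceDiam E v := by
              gcongr
          _ = 2 * Q * b * (F.pieceDiam E v * F.pieceDiam E a) := by ring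
          _ ≤ 2 * Q * b * (Q * F.pieceDiam E (v ++ a)) := by
              exact mul_le_mul_of_nonneg_left (h.quasiMult.le_append v a) (by positivity)
          _ = 2 * Q ^ 2 * b * F.pieceDiam E (v ++ a) := by ring
          _ ≤ _ := by
              gcongr
              exact (h.diam_pos _).le
      · refine ⟨F.wordMap v p, by rw [pieces_append]; exact mem_image_of_mem _ hp, ?_⟩
        rw [Metric.mem_closedBall]
        refine (h.dist_le v p y).trans ?_
        have h2 := Metric.mem_closedBall.1 hpy
        calc Q * F.pieceDiam E v * dist p y ≤ Q * F.pieceDiam E v * η := by gcongr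
          _ ≤ 2 * (Q * F.pieceDiam E v * η) := by
              have : 0 < Q * F.pieceDiam E v * η := by positivity
              linarith
          _ = _ := by ring

/-- If the cardinalities of clusters are bounded, there is a largest number `k` such that clusters
of `k` pieces exist for arbitrarily small `b`. The centre of such a cluster, with `b` so small that
there are no clusters of `k + 1` pieces at a comparable scale, has separated images. -/
theorem exists_separated_of_cluster_bound (h : F.ConformalBounds E Q) {lo : List I → ℝ}
    (hlo : ∀ w, w ≠ [] → lo w ≤ Q * F.pieceDiam E w) {N : ℕ}
    (hN : ∀ k, F.HasCluster E 1 k → k ≤ N) :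
    ∃ (x : M) (ε : ℝ), 0 < ε ∧ ∀ v w : List I, Incomparable v w →
      ε * (lo v + lo w) ≤ dist (F.wordMap v x) (F.wordMap w x) := by
  classical
  have := h.nonempty_index
  have hQ := h.Q_pos
  have hd0 := h.diam_pos []
  obtain ⟨ρ, hρ, hρ1, hρd⟩ := h.exists_ratio
  have hex : ∃ k, ∃ b : ℝ, 0 < b ∧ ¬ F.HasCluster E b k :=
    ⟨N + 1, 1, one_pos, fun hc => absurd (hN _ hc) (by omega)⟩
  have hfind0 : Nat.find hex ≠ 0 := by
    -- the empty family of pieces is a cluster for every `b`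
    intro h0
    obtain ⟨b, hb, hcl⟩ := Nat.find_spec hex
    rw [h0] at hcl
    obtain ⟨y, hy⟩ := h.nonempty
    exact hcl ⟨∅, by simp [PrefixFree], rfl, y, hy, b * F.pieceDiam E [], by positivity, le_rfl,
      by simp⟩
  obtain ⟨k, hk⟩ := Nat.exists_eq_succ_of_ne_zero hfind0
  obtain ⟨b', hb', hno⟩ := Nat.find_spec hex
  rw [hk] at hno
  have hall : ∀ b : ℝ, 0 < b → F.HasCluster E b k := by
    have := Nat.find_min hex (m := k) (by omega)
    push Not at this
    exact this
  -- the scale at which adding a piece to a cluster gives a cluster for `b'`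
  set b := b' * min (1 / (2 * Q ^ 2)) (ρ / (2 * Q * F.pieceDiam E [])) with hbdef
  have hb : 0 < b := by positivity
  have hbQ : 2 * Q ^ 2 * b ≤ b' := by
    have : b ≤ b' * (1 / (2 * Q ^ 2)) := mul_le_mul_of_nonneg_left (min_le_left _ _) hb'.le
    rw [mul_one_div, le_div_iff₀ (by positivity)] at this
    linarith
  have hbρ : 2 * Q * b * F.pieceDiam E [] ≤ b' * ρ := by
    have : b ≤ b' * (ρ / (2 * Q * F.pieceDiam E [])) :=
      mul_le_mul_of_nonneg_left (min_le_right _ _) hb'.le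
    rw [← mul_div_assoc, le_div_iff₀ (by positivity)] at this
    linarith
  obtain ⟨W, hW, hWk, y, hy, η, hη, hη0, hηW⟩ := hall b hb
  have key : ∀ v w : List I, Incomparable v w → F.pieceDiam E w ≤ F.pieceDiam E v →
      η * (lo v + lo w) ≤ dist (F.wordMap v y) (F.wordMap w y) := by
    intro v w hinc hd
    obtain ⟨h1, h2⟩ := incomparable_iff.1 hinc
    by_contra! hlt
    refine hno (hWk ▸ h.hasCluster_succ hρ hρ1 hρd hb hbQ hbρ hW hy hη hη0 hηW h1 h2 hd ?_)
    refine hlt.le.trans ?_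
    calc η * (lo v + lo w) ≤ η * (Q * F.pieceDiam E v + Q * F.pieceDiam E w) := by
          gcongr
          · exact hlo v hinc.1
          · exact hlo w hinc.2.1
      _ = _ := by ring
  refine ⟨y, η, hη, fun v w hinc => ?_⟩
  rcases le_total (F.pieceDiam E w) (F.pieceDiam E v) with hd | hd
  · exact key v w hinc hd
  · rw [dist_comm, add_comm]
    exact key w v ⟨hinc.2.1, hinc.1, hinc.2.2.symm⟩ hd

end ConformalBounds

end IFS

theorem hasPressure_iff {I M : Type*} [Fintype I] [MetricSpace M] (F : IFS I M) (E : Set M)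
    (t p : ℝ) : HasPressure (F.pieces E) t p ↔
      Tendsto (fun n : ℕ => (1 / (n : ℝ)) *
        Real.log (levelSum (fun w => F.pieceDiam E w ^ t) n [])) atTop (𝓝 p) := by
  have e : ∀ n : ℕ, ∑ w : Fin n → I, Metric.diam (F.pieces E (List.ofFn w)) ^ t =
      levelSum (fun w => F.pieceDiam E w ^ t) n [] := fun n =>
    sum_ofFn_eq_levelSum (fun w => F.pieceDiam E w ^ t) n []
  simp only [HasPressure, e]

end Moran

theorem mainTheorem2 {I M : Type*} [Fintype I] [MetricSpace M] [CompleteSpace M]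
    [MeasurableSpace M] [BorelSpace M]
    (hI : 2 ≤ Fintype.card I) (hM : IsDoublingSpace M)
    (F : Moran.IFS I M) (E : Set M) (hE : F.IsInvariantSet E)
    (D : ℝ) (lo hi : List I → ℝ) (hF : F.IsSemiconformal E D lo hi) :
    (∃! t : ℝ, 0 ≤ t ∧ Moran.HasPressure (F.pieces E) t 0) ∧
    ∀ t : ℝ, 0 ≤ t → Moran.HasPressure (F.pieces E) t 0 →
      List.TFAE [
        F.BallCondition E,
        F.FiniteClustering E,
        0 < μH[t] E,
        ∃ (x : M) (ε : ℝ), 0 < ε ∧ ∀ v w : List I, Moran.Incomparable v w →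
          ε * (lo v + lo w) ≤ dist (F.wordMap v x) (F.wordMap w x)] := by
  obtain ⟨Q, h, hlo⟩ := hF.exists_conformalBounds hE
  have := h.nonempty_index
  simp only [Moran.hasPressure_iff]
  obtain ⟨s, hs0, hs1, hs⟩ := h.exists_geometric_bound
  refine ⟨h.quasiMult.existsUnique_pressure_zero hI (h.diam_pos []) hs0 hs1 hs,
    fun t ht0 htP => ?_⟩
  have ht : 0 < t := Moran.pos_of_pressure_zero hI ht0 htP
  have hq := h.quasiMult.rpow ht0
  obtain ⟨m, hm, hfm, hmf⟩ := hq.exists_additive fun n hn => hq.levelSum_bounds htP hn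
  have hC : 0 < (Q ^ t) ^ 2 := pow_pos (Real.rpow_pos_of_pos h.Q_pos t) 2
  have hm0 : ∀ w, 0 < m w := fun w => pos_of_mul_pos_right ((hq.pos w).trans_le (hfm w)) hC.le
  tfae_have 1 → 2 := fun hb =>
    ⟨hb.1, Moran.BallCondition.finiteClustering hM h.isCompact_pieces hb.2⟩
  tfae_have 2 → 1 := fun hc => ⟨hc.1, h.ballCondition hc.2⟩
  tfae_have 2 → 3 := fun hc => h.hausdorffMeasure_pos ht hm hm0 hmf hc.2
  tfae_have 3 → 4 := fun hpos => by
    obtain ⟨N, hN⟩ := h.exists_cluster_bound ht hm hfm hm0 hmf hpos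
    exact h.exists_separated_of_cluster_bound (fun w hw => (hlo w hw).1) hN
  tfae_have 4 → 2 := fun ⟨x, ε, hε, hsep⟩ =>
    ⟨h.isWCMC, h.finiteClustering_of_separated hM (fun w hw => (hlo w hw).2) hε hsep⟩
  tfae_finish
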